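/- Let $X_1,X_2,\dots$ be i.i.d. real random variables and suppose $H_0$ holds: the common law is the standard Cauchy distribution $\mathcal C(0,1)$, with density $1/(\pi(1+x^2))$. Let $$h(x_1,x_2,x_3)=\tfrac13\Big(\mathrm I\big\{\tfrac{x_1x_2-1}{2x_2}\le x_3\big\}+\mathrm I\big\{\tfrac{x_1x_3-1}{2x_3}\le x_2\big\}+\mathrm I\big\{\tfrac{x_2x_3-1}{2x_3}\le x_1\big\}\Big)-\tfrac12,$$ and assume $E[h^2(X_1,X_2,X_3)]<\infty$ and $\mathrm{Var}\big[E\{h(X_1,X_2,X_3)\mid X_1\}\big]>0$. For $n\ge 4$ define $$\widehat\Delta^*_n=\binom n3^{-1}\sum_{1\le k<j<i\le n}\mathrm I\Big\{\frac{X_iX_j-1}{2X_j}\le X_k\Big\}-\frac12,\qquad \widehat J_i=n\widehat\Delta^*_n-(n-1)\widehat\Delta^{*(-i)}_{n-1}\quad(1\le i\le n),$$ where $\widehat\Delta^{*(-i)}_{n-1}$ is the same statistic computed from the $n-1$ observations that remain, in their order, when $X_i$ is deleted. Put $\widehat W_i=\widehat J_i$ for $1\le i\le n$, $\widehat W_{n+1}=-\max\big(1,\tfrac12\log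 n\big)\,\tfrac1n\sum_{i=1}^n\widehat J_i$, and $$\mathcal R_n=\max\Big\{\prod_{i=1}^{n+1}(n+1)p_i:\ p_i\ge0,\ \sum_{i=1}^{n+1}p_i=1,\ \sum_{i=1}^{n+1}p_i\widehat W_i=0\Big\}.$$ Then for every $n\ge4$ and every sample (with nonzero observations, which holds almost surely) there is a real number $\widehat\lambda_2$ with $1+\widehat\lambda_2\widehat W_i>0$ for all $i\le n+1$ and $$\frac1{n+1}\sum_{i=1}^{n+1}\frac{\widehat W_i}{1+\widehat\lambda_2\widehat W_i}=0;$$ for every such $\widehat\lambda_2$ the maximum is attained at $\widehat p_i=\frac1{n+1}\,\frac1{1+\widehat\lambda_2\widehat W_i}$, and $$\log\mathcal R_n=-\sum_{i=1}^{n+1}\log\big(1+\widehat\lambda_2\widehat W_i\big).$$ Moreover, as $n\to\infty$, $-2\log\mathcal R_n$ converges in distribution to the chi-squared distribution with one degree of freedom. -/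

import Mathlib

open MeasureTheory ProbabilityTheory Filter

namespace CauchyAJEL

noncomputable section

open scoped Classical in
/-- The indicator `I{(a b - 1) / (2 b) ≤ c}`. -/
def ind (a b c : ℝ) : ℝ := if (a * b - 1) / (2 * b) ≤ c then 1 else 0

/-- The kernel `h` of degree three. -/
def h (x₁ x₂ x₃ : ℝ) : ℝ :=
  (1 / 3) * (ind x₁ x₂ x₃ + ind x₁ x₃ x₂ + ind x₂ x₃ x₁) - 1 / 2

/-- The statistic `Δ̂*` computed from the observations `x i`, `i ∈ s`:
`(|s| choose 3)⁻¹ ∑_{k < j < i} I{(xᵢ xⱼ - 1) / (2 xⱼ) ≤ xₖ} - 1/2`. -/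
def deltaStar (s : Finset ℕ) (x : ℕ → ℝ) : ℝ :=
  ((s.card.choose 3 : ℕ) : ℝ)⁻¹ *
    (∑ i ∈ s, ∑ j ∈ s with j < i, ∑ k ∈ s with k < j, ind (x i) (x j) (x k)) - 1 / 2

/-- The jackknife pseudo-values `Ĵᵢ = n Δ̂*ₙ - (n - 1) Δ̂*ₙ₋₁^{(-i)}` of the sample
`x 0, …, x (n - 1)`. -/
def pseudoValue (n : ℕ) (x : ℕ → ℝ) (i : ℕ) : ℝ :=
  (n : ℝ) * deltaStar (Finset.range n) x
    - ((n : ℝ) - 1) * deltaStar ((Finset.range n).erase i) x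

/-- The `n + 1` values `Ŵᵢ`: the pseudo-values of the sample `x 0, …, x (n - 1)`, followed by the
additional value `- max (1, log n / 2) * (1/n) ∑ᵢ Ĵᵢ`. -/
def adjustedValue (n : ℕ) (x : ℕ → ℝ) (i : Fin (n + 1)) : ℝ :=
  if (i : ℕ) < n then pseudoValue n x i
  else -max 1 ((1 / 2) * Real.log n) * ((1 / (n : ℝ)) * ∑ j ∈ Finset.range n, pseudoValue n x j)

/-- Probability weights `p` on the values `W i` under which these have mean zero. -/
def feasible {m : ℕ} (W : Fin m → ℝ) : Set (Fin m → ℝ) :=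
  {p | (∀ i, 0 ≤ p i) ∧ ∑ i, p i = 1 ∧ ∑ i, p i * W i = 0}

/-- The empirical likelihood `∏ᵢ (m pᵢ)`, relative to uniform weights. -/
def likelihood {m : ℕ} (p : Fin m → ℝ) : ℝ := ∏ i, (m : ℝ) * p i

/-- The empirical likelihood ratio `max {∏ᵢ (m pᵢ) : p feasible}`. -/
def elRatio {m : ℕ} (W : Fin m → ℝ) : ℝ := sSup (likelihood '' feasible W)

/-- The adjusted jackknife empirical likelihood ratio of the sample `x 0, …, x (n - 1)`. -/
def ajelRatio (n : ℕ) (x : ℕ → ℝ) : ℝ := elRatio (adjustedValue n x)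

/-- `l` is a Lagrange multiplier for `W`: it solves
`(1/m) ∑ᵢ Wᵢ / (1 + l Wᵢ) = 0`, and the weights it gives are positive. -/
def IsMultiplier {m : ℕ} (W : Fin m → ℝ) (l : ℝ) : Prop :=
  (∀ i, 0 < 1 + l * W i) ∧ (1 / (m : ℝ)) * ∑ i, W i / (1 + l * W i) = 0

/-- The weights `p̂ᵢ = (1/m) * 1 / (1 + l Wᵢ)`. -/
def multiplierWeight {m : ℕ} (W : Fin m → ℝ) (l : ℝ) (i : Fin m) : ℝ :=
  (1 / (m : ℝ)) * (1 / (1 + l * W i))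

/-- The chi-squared distribution with one degree of freedom: the law of the square of a standard
normal variable. -/
def chiSquaredOne : Measure ℝ := (gaussianReal 0 1).map (fun z => z ^ 2)

instance : IsProbabilityMeasure chiSquaredOne :=
  Measure.isProbabilityMeasure_map (by fun_prop)

end

end CauchyAJEL

/-!
Lagrange duality for the concave problem of maximizing `∏ (m p_i)` gives the multiplier form of the
ratio `R`, and a second-order expansion in the multiplier gives `-2 log R ≈ (∑ J_i)² / ∑ J_i²`. The
adjusting value is the one that keeps `0` inside the convex hull, and it is negligible because it is
of order `log n / √n` and enters the sums only once.

Each jackknife pseudo-value `J_i` is close in mean square to its conditional expectation given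
`X_i`: the difference has no projection on the single variables, and Efron–Stein type bounds
make it small. So `∑ J_i` behaves as a sum of independent bounded scores and `∑ J_i²` as its
variance. As the kernel is not symmetric, the score of `X_i` depends on the position of `i` in the
sample, and the limit comes from a central limit theorem for triangular arrays. The variance of
`E[h | X_1]` controls the projections of the kernel on its first and on its last argument; when one
of them is nonzero, a positive proportion of the scores has variance bounded below. Finally, a law
symmetric about `0` without atoms makes the statistic odd up to null events, hence centred.
-/

namespace CauchyAJEL

/-- Bounded measurable real functions, the class in which every expectation below is taken. -/
def BddMeas {β : Type*} [MeasurableSpace β] (f : β → ℝ) : Prop :=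
  Measurable f ∧ ∃ C, ∀ x, |f x| ≤ C

namespace BddMeas

variable {β γ : Type*} [MeasurableSpace β] [MeasurableSpace γ] {f g : β → ℝ}

lemma memLp (hf : BddMeas f) (p : ENNReal) (ν : Measure β) [IsFiniteMeasure ν] : MemLp f p ν := by
  obtain ⟨hm, C, hC⟩ := hf
  exact MemLp.of_bound hm.aestronglyMeasurable C (ae_of_all _ hC)

lemma integrable (hf : BddMeas f) (ν : Measure β) [IsFiniteMeasure ν] : Integrable f ν :=
  memLp_one_iff_integrable.1 (hf.memLp 1 ν)

lemma const (c : ℝ) : BddMeas (fun _ : β => c) := ⟨measurable_const, |c|, fun _ => le_rfl⟩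

lemma add (hf : BddMeas f) (hg : BddMeas g) : BddMeas (fun x => f x + g x) := by
  obtain ⟨hm, C, hC⟩ := hf
  obtain ⟨hm', C', hC'⟩ := hg
  exact ⟨hm.add hm', C + C', fun x => (abs_add_le _ _).trans (add_le_add (hC x) (hC' x))⟩

lemma mul (hf : BddMeas f) (hg : BddMeas g) : BddMeas (fun x => f x * g x) := by
  obtain ⟨hm, C, hC⟩ := hf
  obtain ⟨hm', C', hC'⟩ := hg
  refine ⟨hm.mul hm', C * C', fun x => ?_⟩
  rw [abs_mul]
  exact mul_le_mul (hC x) (hC' x) (abs_nonneg _) ((abs_nonneg _).trans (hC x))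

lemma const_mul (c : ℝ) (hf : BddMeas f) : BddMeas (fun x => c * f x) := (const c).mul hf

lemma sub (hf : BddMeas f) (hg : BddMeas g) : BddMeas (fun x => f x - g x) := by
  simpa only [neg_one_mul, ← sub_eq_add_neg] using hf.add (hg.const_mul (-1))

lemma sq (hf : BddMeas f) : BddMeas (fun x => f x ^ 2) := by
  simpa only [pow_two] using hf.mul hf

lemma sum {ι : Type*} {s : Finset ι} {f : ι → β → ℝ} (hf : ∀ i ∈ s, BddMeas (f i)) :
    BddMeas (fun x => ∑ i ∈ s, f i x) := by
  classical
  induction s using Finset.induction_on with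
  | empty => simpa using const 0
  | insert a s ha ih =>
    simp only [Finset.sum_insert ha]
    exact (hf a (Finset.mem_insert_self _ _)).add
      (ih fun i hi => hf i (Finset.mem_insert_of_mem hi))

lemma comp (hf : BddMeas f) {u : γ → β} (hu : Measurable u) : BddMeas (fun x => f (u x)) := by
  obtain ⟨hm, C, hC⟩ := hf
  exact ⟨hm.comp hu, C, fun x => hC _⟩

lemma integral_right {f : β × γ → ℝ} (hf : BddMeas f) (ν : Measure γ) [IsProbabilityMeasure ν] :
    BddMeas (fun x => ∫ y, f (x, y) ∂ν) := by
  obtain ⟨hm, C, hC⟩ := hf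
  refine ⟨hm.stronglyMeasurable.integral_prod_right'.measurable, C, fun x => ?_⟩
  simpa using norm_integral_le_of_norm_le_const (μ := ν) (f := fun y => f (x, y))
    (ae_of_all _ fun y => hC (x, y))

lemma sq_integral_le (hf : BddMeas f) (ν : Measure β) [IsProbabilityMeasure ν] :
    (∫ x, f x ∂ν) ^ 2 ≤ ∫ x, f x ^ 2 ∂ν := by
  have h := variance_nonneg f ν
  rw [variance_eq_sub (hf.memLp 2 ν)] at h
  simpa using sub_nonneg.1 h

lemma integral_sq_le_of_abs_le (hf : BddMeas f) (ν : Measure β) [IsProbabilityMeasure ν] {c : ℝ}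
    (h : ∀ x, |f x| ≤ c) : ∫ x, f x ^ 2 ∂ν ≤ c ^ 2 := by
  refine (integral_mono (hf.sq.integrable ν) (integrable_const (c ^ 2)) fun x =>
    sq_le_sq.2 ((h x).trans (le_abs_self c))).trans ?_
  simp

end BddMeas

/-! ### The Efron–Stein inequality -/

section EfronStein

variable {ι : Type*} [DecidableEq ι] {α : ι → Type*}

lemma preimage_update_pi (i : ι) (s : Set ι) (t : ∀ j, Set (α j)) :
    (fun p : (∀ j, α j) × α i => Function.update p.1 i p.2) ⁻¹' s.pi t
      = (s \ {i}).pi t ×ˢ {a | i ∈ s → a ∈ t i} := by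
  ext ⟨x, a⟩
  simp only [Set.mem_preimage, Set.mem_pi, Set.mem_prod, Set.mem_sdiff, Set.mem_singleton_iff,
    Set.mem_ofPred_eq, Function.forall_update_iff x fun j y => j ∈ s → y ∈ t j]
  tauto

variable [∀ i, MeasurableSpace (α i)] (μ : ∀ i, Measure (α i))

/-- The conditional expectation of `F` given all coordinates but the `i`-th. -/
noncomputable def coordAverage (i : ι) (F : (∀ j, α j) → ℝ) (x : ∀ j, α j) : ℝ :=
  ∫ a, F (Function.update x i a) ∂μ i

/-- The mean square of the change of `F` when the `i`-th coordinate is replaced by a fresh copy. -/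
noncomputable def influence (F : (∀ j, α j) → ℝ) (i : ι) : ℝ :=
  ∫ x, ∫ a, (F x - F (Function.update x i a)) ^ 2 ∂μ i ∂Measure.infinitePi μ

variable {F : (∀ j, α j) → ℝ} (i : ι)

lemma dependsOn_coordAverage {s : Set ι} (hs : DependsOn F s) :
    DependsOn (coordAverage μ i F) (s \ {i}) := by
  intro x y hxy
  refine integral_congr_ae (ae_of_all _ fun a => hs fun j hj => ?_)
  by_cases hji : j = i
  · subst hji
    simp
  · simpa only [Function.update_of_ne hji] using hxy j ⟨hj, hji⟩

variable [∀ i, IsProbabilityMeasure (μ i)]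

lemma map_update_infinitePi :
    ((Measure.infinitePi μ).prod (μ i)).map (fun p => Function.update p.1 i p.2)
      = Measure.infinitePi μ := by
  refine Measure.eq_infinitePi μ fun s t ht => ?_
  rw [Measure.map_apply measurable_update' (.pi s.countable_toSet fun j _ => ht j),
    preimage_update_pi, Measure.prod_prod, ← Finset.coe_erase,
    Measure.infinitePi_pi μ fun j _ => ht j]
  by_cases hi : i ∈ s
  · simp [hi, Finset.prod_erase_mul s (fun j => μ j (t j)) hi]
  · simp [hi]

lemma integral_coordAverage (hF : Integrable F (Measure.infinitePi μ)) :
    ∫ x, coordAverage μ i F x ∂Measure.infinitePi μ = ∫ x, F x ∂Measure.infinitePi μ := by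
  have hF' := hF
  rw [← map_update_infinitePi μ i] at hF'
  conv_rhs => rw [← map_update_infinitePi μ i]
  rw [integral_map measurable_update'.aemeasurable hF'.aestronglyMeasurable]
  exact (integral_prod _ (hF'.comp_measurable measurable_update')).symm

lemma BddMeas.update (hF : BddMeas F) :
    BddMeas (fun p : (∀ j, α j) × α i => F (Function.update p.1 i p.2)) :=
  hF.comp measurable_update'

lemma BddMeas.update_right (hF : BddMeas F) (x : ∀ j, α j) :
    BddMeas (fun a => F (Function.update x i a)) :=
  hF.comp (measurable_update x)

lemma BddMeas.coordAverage (hF : BddMeas F) : BddMeas (coordAverage μ i F) :=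
  (hF.update i).integral_right (μ i)

lemma BddMeas.sub_update_sq (hF : BddMeas F) :
    BddMeas (fun p : (∀ j, α j) × α i => (F p.1 - F (Function.update p.1 i p.2)) ^ 2) :=
  ((hF.comp measurable_fst).sub (hF.update i)).sq

lemma influence_le {i : ι} (hF : BddMeas F) {c : ℝ}
    (h : ∀ x a, |F x - F (Function.update x i a)| ≤ c) : influence μ F i ≤ c ^ 2 := by
  refine (integral_mono (((hF.sub_update_sq i).integral_right _).integrable _)
    (integrable_const (c ^ 2)) fun x => ?_).trans (by simp)
  exact ((BddMeas.const (F x)).sub (hF.update_right i x)).integral_sq_le_of_abs_le _ (h x)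

lemma sub_coordAverage (hF : BddMeas F) (x : ∀ j, α j) :
    F x - coordAverage μ i F x = ∫ a, (F x - F (Function.update x i a)) ∂μ i := by
  rw [integral_sub (integrable_const _) ((hF.update_right i x).integrable _)]
  simp [coordAverage]

lemma integral_sub_coordAverage_sq_le_influence (hF : BddMeas F) :
    ∫ x, (F x - coordAverage μ i F x) ^ 2 ∂Measure.infinitePi μ ≤ influence μ F i := by
  refine integral_mono ((hF.sub (hF.coordAverage μ i)).sq.integrable _)
    (((hF.sub_update_sq i).integral_right _).integrable _) fun x => ?_
  simp only [sub_coordAverage μ i hF]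
  exact ((BddMeas.const _).sub (hF.update_right i x)).sq_integral_le _

lemma integral_sub_coordAverage_mul (hF : BddMeas F) (c : ℝ) :
    ∫ x, (F x - coordAverage μ i F x) * (coordAverage μ i F x - c) ∂Measure.infinitePi μ = 0 := by
  have hG := hF.coordAverage μ i
  rw [← integral_coordAverage μ i
    (((hF.sub hG).mul (hG.sub (BddMeas.const c))).integrable _)]
  refine integral_eq_zero_of_ae (ae_of_all _ fun x => ?_)
  simp only [coordAverage, Function.update_idem, integral_mul_const]
  rw [integral_sub ((hF.update_right i x).integrable _) (integrable_const _)]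
  simp

lemma variance_eq_add_variance_coordAverage (hF : BddMeas F) :
    variance F (Measure.infinitePi μ)
      = ∫ x, (F x - coordAverage μ i F x) ^ 2 ∂Measure.infinitePi μ
        + variance (coordAverage μ i F) (Measure.infinitePi μ) := by
  have hG := hF.coordAverage μ i
  rw [variance_eq_integral hF.1.aemeasurable, variance_eq_integral hG.1.aemeasurable,
    integral_coordAverage μ i (hF.integrable _)]
  set c := ∫ x, F x ∂Measure.infinitePi μ
  have hexpand : ∀ x, (F x - c) ^ 2 = (F x - coordAverage μ i F x) ^ 2
      + (2 * ((F x - coordAverage μ i F x) * (coordAverage μ i F x - c))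
        + (coordAverage μ i F x - c) ^ 2) := fun x => by ring
  have hcross := ((hF.sub hG).mul (hG.sub (BddMeas.const c))).const_mul 2
  have hsq := (hG.sub (BddMeas.const c)).sq
  simp only [hexpand]
  rw [integral_add ((hF.sub hG).sq.integrable _) ((hcross.add hsq).integrable _),
    integral_add (hcross.integrable _) (hsq.integrable _), integral_const_mul,
    integral_sub_coordAverage_mul μ i hF, mul_zero, zero_add]

lemma coordAverage_sub_update {i j : ι} (hF : BddMeas F) (hij : j ≠ i) (x : ∀ j, α j) (b : α j) :
    coordAverage μ i F x - coordAverage μ i F (Function.update x j b)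
      = ∫ a, (F (Function.update x i a)
        - F (Function.update (Function.update x i a) j b)) ∂μ i := by
  rw [coordAverage, coordAverage, ← integral_sub ((hF.update_right i x).integrable _)
    ((hF.update_right i _).integrable _)]
  simp only [Function.update_comm hij]

lemma influence_coordAverage_le {i j : ι} (hF : BddMeas F) (hij : j ≠ i) :
    influence μ (coordAverage μ i F) j ≤ influence μ F j := by
  have hdiff (x : ∀ j, α j) : BddMeas fun p : α j × α i =>
      F (Function.update x i p.2) - F (Function.update (Function.update x i p.2) j p.1) := by
    have hi : Measurable fun p : α j × α i => Function.update x i p.2 :=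
      (measurable_update x).comp measurable_snd
    exact (hF.comp hi).sub (hF.comp (measurable_update'.comp (hi.prodMk measurable_fst)))
  have hV : BddMeas fun x => ∫ b, (F x - F (Function.update x j b)) ^ 2 ∂μ j :=
    (hF.sub_update_sq j).integral_right (μ j)
  rw [influence, influence, ← integral_coordAverage μ i (hV.integrable _)]
  refine integral_mono ((((hF.coordAverage μ i).sub_update_sq j).integral_right _).integrable _)
    ((hV.coordAverage μ i).integrable _) fun x => ?_
  have hswap := integral_integral_swap (μ := μ i) (ν := μ j)
    (f := fun a b => (F (Function.update x i a)
      - F (Function.update (Function.update x i a) j b)) ^ 2)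
    (((hdiff x).sq.comp measurable_swap).integrable ((μ i).prod (μ j)))
  simp only [coordAverage_sub_update μ hF hij]
  refine (integral_mono (((hdiff x).integral_right (μ i)).sq.integrable _)
    (((hdiff x).sq.integral_right (μ i)).integrable _) fun b => ?_).trans_eq hswap.symm
  exact ((hdiff x).comp measurable_prodMk_left).sq_integral_le _

theorem variance_le_sum_influence (s : Finset ι) (hF : BddMeas F) (hs : DependsOn F s) :
    variance F (Measure.infinitePi μ) ≤ ∑ i ∈ s, influence μ F i := by
  induction s using Finset.induction_on generalizing F with
  | empty =>
    have hconst : ∀ x y, F x = F y := fun x y => hs (by simp)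
    rw [variance_eq_integral hF.1.aemeasurable]
    refine (integral_eq_zero_of_ae (ae_of_all _ fun x => ?_)).le
    rw [integral_congr_ae (ae_of_all _ fun y => hconst y x)]
    simp
  | insert i s hi ih =>
    have hsi : DependsOn (coordAverage μ i F) s := by
      simpa [hi] using dependsOn_coordAverage μ i hs
    calc variance F (Measure.infinitePi μ)
        = ∫ x, (F x - coordAverage μ i F x) ^ 2 ∂Measure.infinitePi μ
          + variance (coordAverage μ i F) (Measure.infinitePi μ) :=
          variance_eq_add_variance_coordAverage μ i hF
      _ ≤ influence μ F i + ∑ j ∈ s, influence μ (coordAverage μ i F) j :=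
          add_le_add (integral_sub_coordAverage_sq_le_influence μ i hF)
            (ih (hF.coordAverage μ i) hsi)
      _ ≤ influence μ F i + ∑ j ∈ s, influence μ F j :=
          add_le_add_right (Finset.sum_le_sum fun j hj =>
            influence_coordAverage_le μ hF (ne_of_mem_of_not_mem hj hi)) _
      _ = ∑ j ∈ insert i s, influence μ F j := (Finset.sum_insert hi).symm

end EfronStein

/-! ### Empirical likelihood and its Lagrange multiplier -/

section EmpiricalLikelihood

variable {m : ℕ} {W : Fin m → ℝ} {l : ℝ}

lemma IsMultiplier.sum_eq_zero (hl : IsMultiplier W l) : ∑ i, W i / (1 + l * W i) = 0 := by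
  rcases Nat.eq_zero_or_pos m with rfl | hm
  · simp
  · exact (mul_eq_zero.1 hl.2).resolve_left (by positivity)

lemma multiplierWeight_mem_feasible (hm : 0 < m) (hl : IsMultiplier W l) :
    multiplierWeight W l ∈ feasible W := by
  have hm' : (m : ℝ) ≠ 0 := by positivity
  have hinv (i : Fin m) : 1 / (1 + l * W i) = 1 - l * (W i / (1 + l * W i)) := by
    have := (hl.1 i).ne'
    field_simp
    ring
  refine ⟨fun i => ?_, ?_, ?_⟩
  · have := hl.1 i
    unfold multiplierWeight
    positivity
  · simp only [multiplierWeight, ← Finset.mul_sum, hinv, Finset.sum_sub_distrib, hl.sum_eq_zero]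
    simp [hm']
  · calc ∑ i, multiplierWeight W l i * W i
        = ∑ i, (1 / (m : ℝ)) * (W i / (1 + l * W i)) :=
          Finset.sum_congr rfl fun i _ => by unfold multiplierWeight; ring
      _ = 0 := by rw [← Finset.mul_sum, hl.sum_eq_zero, mul_zero]

lemma likelihood_multiplierWeight (hm : 0 < m) :
    likelihood (multiplierWeight W l) = (∏ i, (1 + l * W i))⁻¹ := by
  have hm' : (m : ℝ) ≠ 0 := by positivity
  unfold likelihood multiplierWeight
  rw [← Finset.prod_inv_distrib]
  refine Finset.prod_congr rfl fun i _ => ?_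
  field_simp

lemma sum_mul_sub_one_eq_zero {p : Fin m → ℝ} (hp : p ∈ feasible W) :
    ∑ i, ((m : ℝ) * p i * (1 + l * W i) - 1) = 0 := by
  obtain ⟨-, hp1, hp2⟩ := hp
  calc ∑ i, ((m : ℝ) * p i * (1 + l * W i) - 1)
      = ∑ i, (m * p i + m * l * (p i * W i)) - m := by
        simp only [Finset.sum_sub_distrib, Finset.sum_const, Finset.card_univ, Fintype.card_fin,
          nsmul_eq_mul, mul_one]
        congr 1
        exact Finset.sum_congr rfl fun i _ => by ring
    _ = 0 := by simp only [Finset.sum_add_distrib, ← Finset.mul_sum, hp1, hp2]; ring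

-- `1 + t ≤ exp t` at `t = m pᵢ (1 + l Wᵢ) - 1`, and these `t` sum to zero.
lemma isMaxOn_likelihood (hm : 0 < m) (hl : IsMultiplier W l) :
    IsMaxOn likelihood (feasible W) (multiplierWeight W l) := by
  intro p hp
  change likelihood p ≤ _
  rw [likelihood_multiplierWeight hm, ← one_div,
    le_div_iff₀ (Finset.prod_pos fun i _ => hl.1 i), likelihood, ← Finset.prod_mul_distrib]
  calc ∏ i, (m : ℝ) * p i * (1 + l * W i)
      ≤ ∏ i, Real.exp ((m : ℝ) * p i * (1 + l * W i) - 1) := by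
        refine Finset.prod_le_prod (fun i _ => ?_) fun i _ => ?_
        · have := hp.1 i
          have := (hl.1 i).le
          positivity
        · linarith [Real.add_one_le_exp ((m : ℝ) * p i * (1 + l * W i) - 1)]
    _ = 1 := by rw [← Real.exp_sum, sum_mul_sub_one_eq_zero hp, Real.exp_zero]

lemma log_elRatio (hm : 0 < m) (hl : IsMultiplier W l) :
    Real.log (elRatio W) = -∑ i, Real.log (1 + l * W i) := by
  have hmax : elRatio W = likelihood (multiplierWeight W l) := by
    refine IsGreatest.csSup_eq ⟨⟨_, multiplierWeight_mem_feasible hm hl, rfl⟩, ?_⟩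
    rintro _ ⟨p, hp, rfl⟩
    exact isMaxOn_likelihood hm hl hp
  rw [hmax, likelihood_multiplierWeight hm, Real.log_inv, Real.log_prod fun i _ => (hl.1 i).ne']

lemma neg_abs_le_div_one_add_mul {w : ℝ} (hl : l ≤ 0) (h : 0 < 1 + l * w) :
    -|w| ≤ w / (1 + l * w) := by
  rcases le_total 0 w with hw | hw
  · exact (neg_nonpos.2 (abs_nonneg w)).trans (div_nonneg hw h.le)
  · rw [abs_of_nonpos hw, neg_neg, le_div_iff₀ h]
    nlinarith [mul_nonneg_of_nonpos_of_nonpos hl hw]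

-- For `l = -1 / max W + 1 / ∑ |W|` the term of the largest `W j` alone is `∑ |W|`.
lemma exists_nonpos_sum_div_nonneg (hpos : ∃ i, 0 < W i) :
    ∃ l ≤ 0, (∀ i, 0 < 1 + l * W i) ∧ 0 ≤ ∑ i, W i / (1 + l * W i) := by
  obtain ⟨i₀, hi₀⟩ := hpos
  obtain ⟨j, -, hj⟩ := Finset.exists_max_image Finset.univ W ⟨i₀, Finset.mem_univ _⟩
  have hWj : 0 < W j := hi₀.trans_le (hj i₀ (Finset.mem_univ _))
  set B : ℝ := ∑ i, |W i|
  have hBj : W j ≤ B := (le_abs_self _).trans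
    (Finset.single_le_sum (f := fun i => |W i|) (fun i _ => abs_nonneg _) (Finset.mem_univ j))
  have hB0 : 0 < B := hWj.trans_le hBj
  obtain ⟨l, hl⟩ : ∃ l : ℝ, l = -1 / W j + 1 / B := ⟨_, rfl⟩
  have hl0 : l ≤ 0 := by
    rw [hl, neg_div]
    linarith [one_div_le_one_div_of_le hWj hBj]
  have hlj : 1 + l * W j = W j / B := by
    rw [hl]
    field_simp
    ring
  have hdom (i : Fin m) : 0 < 1 + l * W i := by
    have : 0 < W j / B := by positivity
    linarith [mul_le_mul_of_nonpos_left (hj i (Finset.mem_univ _)) hl0]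
  refine ⟨l, hl0, hdom, ?_⟩
  have hjterm : W j / (1 + l * W j) = B := by
    rw [hlj]
    field_simp
  calc 0 ≤ B + ∑ i ∈ Finset.univ.erase j, -|W i| := by
        rw [Finset.sum_neg_distrib, ← sub_eq_add_neg, sub_nonneg]
        exact Finset.sum_le_sum_of_subset_of_nonneg (Finset.erase_subset _ _)
          fun i _ _ => abs_nonneg _
    _ ≤ W j / (1 + l * W j) + ∑ i ∈ Finset.univ.erase j, W i / (1 + l * W i) :=
        add_le_add hjterm.ge
          (Finset.sum_le_sum fun i _ => neg_abs_le_div_one_add_mul hl0 (hdom i))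
    _ = ∑ i, W i / (1 + l * W i) :=
        Finset.add_sum_erase _ (fun i => W i / (1 + l * W i)) (Finset.mem_univ j)

lemma one_add_mul_pos_of_mem_Icc {a b w : ℝ} (ha : 0 < 1 + a * w) (hb : 0 < 1 + b * w)
    (hl : l ∈ Set.Icc a b) : 0 < 1 + l * w := by
  rcases le_total 0 w with hw | hw
  · linarith [mul_le_mul_of_nonneg_right hl.1 hw]
  · linarith [mul_le_mul_of_nonpos_right hl.2 hw]

lemma exists_isMultiplier (hpos : ∃ i, 0 < W i) (hneg : ∃ i, W i < 0) :
    ∃ l, IsMultiplier W l := by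
  obtain ⟨a, ha0, ha, hasum⟩ := exists_nonpos_sum_div_nonneg hpos
  obtain ⟨b, hb0, hb, hbsum⟩ := exists_nonpos_sum_div_nonneg (W := fun i => -W i)
    (by simpa using hneg)
  have hdom : ∀ l ∈ Set.Icc a (-b), ∀ i, 0 < 1 + l * W i := fun l hl i =>
    one_add_mul_pos_of_mem_Icc (ha i) (by simpa using hb i) hl
  have hcont : ContinuousOn (fun l => ∑ i, W i / (1 + l * W i)) (Set.Icc a (-b)) :=
    continuousOn_finsetSum _ fun i _ =>
      continuousOn_const.div (by fun_prop) fun l hl => (hdom l hl i).ne'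
  have hbsum' : ∑ i, W i / (1 + -b * W i) ≤ 0 := by
    simpa [neg_div, Finset.sum_neg_distrib] using hbsum
  obtain ⟨l, hl, hl0⟩ := intermediate_value_Icc' (by linarith) hcont ⟨hbsum', hasum⟩
  exact ⟨l, hdom l hl, mul_eq_zero_of_right _ hl0⟩

lemma exists_isMultiplier_of_sum_mul_eq_zero {c : Fin m → ℝ} (hc : ∀ i, 0 < c i)
    (h : ∑ i, c i * W i = 0) : ∃ l, IsMultiplier W l := by
  by_cases hW : ∀ i, W i = 0
  · exact ⟨0, by simp [IsMultiplier, hW]⟩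
  push Not at hW
  obtain ⟨j, hj⟩ := hW
  have hcj : c j * W j ≠ 0 := mul_ne_zero (hc j).ne' hj
  obtain ⟨i, -, hi⟩ := Finset.exists_pos_of_sum_zero_of_exists_nonzero _ h
    ⟨j, Finset.mem_univ j, hcj⟩
  obtain ⟨k, -, hk⟩ := Finset.exists_pos_of_sum_zero_of_exists_nonzero
    (s := Finset.univ) (fun i => -(c i * W i)) (by simpa using h)
    ⟨j, Finset.mem_univ j, neg_ne_zero.2 hcj⟩
  exact exists_isMultiplier ⟨i, (pos_iff_pos_of_mul_pos hi).1 (hc i)⟩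
    ⟨k, by nlinarith [hc k]⟩

end EmpiricalLikelihood

section Adjustment

variable {n : ℕ} {x y : ℕ → ℝ}

lemma adjustedValue_castSucc (n : ℕ) (x : ℕ → ℝ) (i : Fin n) :
    adjustedValue n x i.castSucc = pseudoValue n x i := by
  simp [adjustedValue]

lemma adjustedValue_last (n : ℕ) (x : ℕ → ℝ) :
    adjustedValue n x (Fin.last n) = -max 1 ((1 / 2) * Real.log n)
      * ((1 / (n : ℝ)) * ∑ j ∈ Finset.range n, pseudoValue n x j) := by
  simp [adjustedValue]

-- The additional value is a negative multiple of `∑ᵢ Ĵᵢ`, so that zero is a convex combination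
-- of all the values with positive weights.
lemma exists_isMultiplier_adjustedValue (hn : 0 < n) (x : ℕ → ℝ) :
    ∃ l, IsMultiplier (adjustedValue n x) l := by
  refine exists_isMultiplier_of_sum_mul_eq_zero
    (c := Fin.snoc (fun _ : Fin n => max 1 ((1 / 2) * Real.log n) * (1 / (n : ℝ))) 1)
    (fun i => ?_) ?_
  · refine Fin.lastCases (by simp) (fun i => ?_) i
    rw [Fin.snoc_castSucc (α := fun _ => ℝ)]
    exact mul_pos (lt_max_of_lt_left one_pos) (by positivity)
  · rw [Fin.sum_univ_castSucc]
    simp only [Fin.snoc_castSucc, Fin.snoc_last, adjustedValue_castSucc, adjustedValue_last,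
      ← Finset.mul_sum, Finset.sum_range]
    ring

lemma deltaStar_congr {s : Finset ℕ}
    (h : ∀ i ∈ s, ∀ j ∈ s, ∀ k ∈ s, ind (x i) (x j) (x k) = ind (y i) (y j) (y k)) :
    deltaStar s x = deltaStar s y := by
  unfold deltaStar
  congr 2
  exact Finset.sum_congr rfl fun i hi => Finset.sum_congr rfl fun j hj =>
    Finset.sum_congr rfl fun k hk =>
      h i hi j (Finset.mem_filter.1 hj).1 k (Finset.mem_filter.1 hk).1

lemma ajelRatio_congr
    (h : ∀ i < n, ∀ j < n, ∀ k < n, ind (x i) (x j) (x k) = ind (y i) (y j) (y k)) :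
    ajelRatio n x = ajelRatio n y := by
  have hdelta : ∀ s ⊆ Finset.range n, deltaStar s x = deltaStar s y := fun s hs =>
    deltaStar_congr fun i hi j hj k hk => h i (Finset.mem_range.1 (hs hi))
      j (Finset.mem_range.1 (hs hj)) k (Finset.mem_range.1 (hs hk))
  have hpseudo (i : ℕ) : pseudoValue n x i = pseudoValue n y i := by
    rw [pseudoValue, pseudoValue, hdelta _ subset_rfl, hdelta _ (Finset.erase_subset _ _)]
  rw [ajelRatio, ajelRatio]
  congr 1
  funext i
  simp only [adjustedValue, hpseudo]

lemma measurable_ind : Measurable (fun p : ℝ × ℝ × ℝ => ind p.1 p.2.1 p.2.2) :=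
  Measurable.ite (measurableSet_le (by fun_prop) (by fun_prop)) measurable_const measurable_const

-- `ajelRatio n` is a function of finitely many indicators, hence measurable although it is
-- defined by a supremum.
lemma measurable_ajelRatio (n : ℕ) : Measurable (ajelRatio n) := by
  let pattern (x : ℕ → ℝ) (i j k : Fin n) : Prop := (x i * x j - 1) / (2 * x j) ≤ x k
  have hpattern : Measurable pattern :=
    measurable_pi_lambda _ fun i => measurable_pi_lambda _ fun j => measurable_pi_lambda _ fun k =>
      measurableSet_setOfPred.1 (measurableSet_le (by fun_prop) (by fun_prop))
  have hfactor : (ajelRatio n).FactorsThrough pattern := by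
    refine fun x y hxy => ajelRatio_congr fun i hi j hj k hk => ?_
    have hijk := congrFun (congrFun (congrFun hxy ⟨i, hi⟩) ⟨j, hj⟩) ⟨k, hk⟩
    simp only [pattern, eq_iff_iff] at hijk
    simp only [ind, hijk]
  rw [show ajelRatio n = Function.extend pattern (ajelRatio n) 0 ∘ pattern from
    funext fun x => (hfactor.extend_apply 0 x).symm]
  exact Measurable.of_discrete.comp hpattern

end Adjustment

/-! ### Wilks' theorem for the empirical likelihood ratio -/

lemma abs_log_one_add_sub_le {u : ℝ} (hu : |u| ≤ 1 / 2) :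
    |Real.log (1 + u) - (u - u ^ 2 / 2)| ≤ 2 * |u| ^ 3 := by
  have htaylor := Real.abs_log_sub_add_sum_range_le (x := -u) (by rw [abs_neg]; linarith) 2
  simp only [Finset.sum_range_succ, Finset.sum_range_zero, abs_neg] at htaylor
  norm_num at htaylor
  have hdiv : |u| ^ 3 / (1 - |u|) ≤ 2 * |u| ^ 3 := by
    rw [div_le_iff₀ (by linarith)]
    nlinarith [pow_nonneg (abs_nonneg u) 3]
  refine le_trans (le_of_eq ?_) (htaylor.trans hdiv)
  congr 1
  ring

section Expansion

variable {m : ℕ} {W : Fin m → ℝ} {l K : ℝ}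

lemma IsMultiplier.sum_eq_mul_sum_sq_div (hl : IsMultiplier W l) :
    ∑ i, W i = l * ∑ i, W i ^ 2 / (1 + l * W i) := by
  calc ∑ i, W i = ∑ i, (W i / (1 + l * W i) + l * (W i ^ 2 / (1 + l * W i))) :=
        Finset.sum_congr rfl fun i _ => by
          rw [mul_div_assoc', ← add_div, eq_div_iff (hl.1 i).ne']
          ring
    _ = l * ∑ i, W i ^ 2 / (1 + l * W i) := by
        rw [Finset.sum_add_distrib, hl.sum_eq_zero, zero_add, Finset.mul_sum]

lemma IsMultiplier.abs_mul_sum_sq_le (hl : IsMultiplier W l) (hW : ∀ i, |W i| ≤ K) (hK : 0 ≤ K) :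
    |l| * ∑ i, W i ^ 2 ≤ |∑ i, W i| * (1 + |l| * K) := by
  have hpos : 0 < 1 + |l| * K := by positivity
  have hle : (∑ i, W i ^ 2) / (1 + |l| * K) ≤ ∑ i, W i ^ 2 / (1 + l * W i) := by
    rw [Finset.sum_div]
    refine Finset.sum_le_sum fun i _ => div_le_div_of_nonneg_left (sq_nonneg _) (hl.1 i) ?_
    have : l * W i ≤ |l| * K := (le_abs_self _).trans
      (by rw [abs_mul]; exact mul_le_mul_of_nonneg_left (hW i) (abs_nonneg _))
    linarith
  have hnonneg : 0 ≤ ∑ i, W i ^ 2 / (1 + l * W i) :=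
    Finset.sum_nonneg fun i _ => div_nonneg (sq_nonneg _) (hl.1 i).le
  rw [hl.sum_eq_mul_sum_sq_div, abs_mul, abs_of_nonneg hnonneg, mul_assoc]
  exact mul_le_mul_of_nonneg_left ((div_le_iff₀ hpos).1 hle) (abs_nonneg _)

lemma IsMultiplier.abs_mul_sum_sq_le_two_mul (hl : IsMultiplier W l) (hW : ∀ i, |W i| ≤ K)
    (hK : 0 ≤ K) (hAB : 4 * K * |∑ i, W i| ≤ ∑ i, W i ^ 2) :
    |l| * ∑ i, W i ^ 2 ≤ 2 * |∑ i, W i| := by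
  nlinarith [hl.abs_mul_sum_sq_le hW hK, mul_le_mul_of_nonneg_left hAB (abs_nonneg l),
    abs_nonneg l, abs_nonneg (∑ i, W i)]

lemma IsMultiplier.abs_mul_le_half (hl : IsMultiplier W l) (hW : ∀ i, |W i| ≤ K) (hK : 0 ≤ K)
    (hB : 0 < ∑ i, W i ^ 2) (hAB : 4 * K * |∑ i, W i| ≤ ∑ i, W i ^ 2) : |l| * K ≤ 1 / 2 := by
  have hlB := hl.abs_mul_sum_sq_le_two_mul hW hK hAB
  refine le_of_mul_le_mul_right ?_ hB
  nlinarith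

lemma abs_mul_apply_le_half (hW : ∀ i, |W i| ≤ K) (hlK : |l| * K ≤ 1 / 2) (i : Fin m) :
    |l * W i| ≤ 1 / 2 := by
  rw [abs_mul]
  exact (mul_le_mul_of_nonneg_left (hW i) (abs_nonneg _)).trans hlK

lemma abs_pow_three_le (hW : ∀ i, |W i| ≤ K) (i : Fin m) : |W i| ^ 3 ≤ K * W i ^ 2 := by
  rw [pow_succ, sq_abs, mul_comm]
  exact mul_le_mul_of_nonneg_right (hW i) (sq_nonneg _)

lemma IsMultiplier.abs_sum_sub_mul_sum_sq_le (hl : IsMultiplier W l) (hW : ∀ i, |W i| ≤ K)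
    (hlK : |l| * K ≤ 1 / 2) : |∑ i, W i - l * ∑ i, W i ^ 2| ≤ 2 * l ^ 2 * K * ∑ i, W i ^ 2 := by
  have hsum : ∑ i, W i - l * ∑ i, W i ^ 2 = -∑ i, l ^ 2 * W i ^ 3 / (1 + l * W i) := by
    calc ∑ i, W i - l * ∑ i, W i ^ 2
        = l * ∑ i, (W i ^ 2 / (1 + l * W i) - W i ^ 2) := by
          rw [Finset.sum_sub_distrib, mul_sub, ← hl.sum_eq_mul_sum_sq_div]
      _ = -∑ i, l ^ 2 * W i ^ 3 / (1 + l * W i) := by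
          rw [Finset.mul_sum, ← Finset.sum_neg_distrib]
          refine Finset.sum_congr rfl fun i _ => ?_
          have := (hl.1 i).ne'
          field_simp
          ring
  rw [hsum, abs_neg, Finset.mul_sum]
  refine (Finset.abs_sum_le_sum_abs _ _).trans (Finset.sum_le_sum fun i _ => ?_)
  have hhalf : 1 / 2 ≤ 1 + l * W i := by
    linarith [neg_abs_le (l * W i), abs_mul_apply_le_half hW hlK i]
  rw [abs_div, abs_of_pos (hl.1 i), div_le_iff₀ (hl.1 i), abs_mul, abs_pow, abs_pow, sq_abs]
  have hcube := mul_le_mul_of_nonneg_left (abs_pow_three_le hW i) (sq_nonneg l)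
  have hpos : 0 ≤ l ^ 2 * |W i| ^ 3 := by positivity
  nlinarith

lemma abs_sum_log_sub_le (hW : ∀ i, |W i| ≤ K) (hlK : |l| * K ≤ 1 / 2) :
    |∑ i, Real.log (1 + l * W i) - (l * ∑ i, W i - l ^ 2 * (∑ i, W i ^ 2) / 2)|
      ≤ 2 * |l| ^ 3 * K * ∑ i, W i ^ 2 := by
  have hsum : ∑ i, Real.log (1 + l * W i) - (l * ∑ i, W i - l ^ 2 * (∑ i, W i ^ 2) / 2)
      = ∑ i, (Real.log (1 + l * W i) - (l * W i - (l * W i) ^ 2 / 2)) := by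
    simp only [Finset.sum_sub_distrib, ← Finset.mul_sum, ← Finset.sum_div, mul_pow]
  rw [hsum, Finset.mul_sum]
  refine (Finset.abs_sum_le_sum_abs _ _).trans (Finset.sum_le_sum fun i _ => ?_)
  refine (abs_log_one_add_sub_le (abs_mul_apply_le_half hW hlK i)).trans ?_
  rw [abs_mul, mul_pow]
  nlinarith [mul_le_mul_of_nonneg_left (abs_pow_three_le hW i)
    (by positivity : 0 ≤ 2 * |l| ^ 3)]

-- `2 (l A - l² B / 2) - A² / B = -(A - l B)² / B` for `A = ∑ Wᵢ`, `B = ∑ Wᵢ²`.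
lemma IsMultiplier.abs_two_mul_sum_log_sub_le (hl : IsMultiplier W l) (hW : ∀ i, |W i| ≤ K)
    (hK : 0 ≤ K) (hB : 0 < ∑ i, W i ^ 2) (hAB : 4 * K * |∑ i, W i| ≤ ∑ i, W i ^ 2) :
    |2 * ∑ i, Real.log (1 + l * W i) - (∑ i, W i) ^ 2 / ∑ i, W i ^ 2|
      ≤ 48 * K * |∑ i, W i| ^ 3 / (∑ i, W i ^ 2) ^ 2 := by
  have hlB := hl.abs_mul_sum_sq_le_two_mul hW hK hAB
  have hlK := hl.abs_mul_le_half hW hK hB hAB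
  have hdiff := hl.abs_sum_sub_mul_sum_sq_le hW hlK
  have hlog := abs_sum_log_sub_le hW hlK
  set A := ∑ i, W i
  set B := ∑ i, W i ^ 2
  have hquad : 2 * (l * A - l ^ 2 * B / 2) - A ^ 2 / B = -((A - l * B) ^ 2 / B) := by
    field_simp
    ring
  have hsq : (A - l * B) ^ 2 / B ≤ 2 * |l| ^ 3 * K * B := by
    rw [div_le_iff₀ hB]
    calc (A - l * B) ^ 2 ≤ (2 * l ^ 2 * K * B) ^ 2 := by
          rw [← sq_abs]
          exact pow_le_pow_left₀ (abs_nonneg _) hdiff 2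
      _ = 4 * (|l| ^ 3 * K * B * B) * (|l| * K) := by rw [← sq_abs l]; ring
      _ ≤ 4 * (|l| ^ 3 * K * B * B) * (1 / 2) := by gcongr
      _ = 2 * |l| ^ 3 * K * B * B := by ring
  have hsq_nonneg : 0 ≤ (A - l * B) ^ 2 / B := by positivity
  have hlambda : |2 * ∑ i, Real.log (1 + l * W i) - A ^ 2 / B| ≤ 6 * |l| ^ 3 * K * B := by
    rw [abs_le] at hlog ⊢
    constructor <;> linarith [hlog.1, hlog.2]
  refine hlambda.trans ?_
  rw [le_div_iff₀ (by positivity)]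
  calc 6 * |l| ^ 3 * K * B * B ^ 2 = 6 * K * (|l| * B) ^ 3 := by ring
    _ ≤ 6 * K * (2 * |A|) ^ 3 := by gcongr
    _ = 48 * K * |A| ^ 3 := by ring

lemma IsMultiplier.abs_neg_two_mul_log_elRatio_sub_le {s u v : ℝ} (hm : 0 < m)
    (hl : IsMultiplier W l) (hW : ∀ i, |W i| ≤ K) (hs : 0 < s) (hu : u = (∑ i, W i) / s)
    (hv : v = (∑ i, W i ^ 2) / s ^ 2) (hv_half : 1 / 2 ≤ v) (hsmall : 8 * (K / s) * |u| ≤ 1) :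
    |-2 * Real.log (elRatio W) - u ^ 2 / v| ≤ 192 * (K / s) * |u| ^ 3 := by
  have hK : 0 ≤ K := (abs_nonneg _).trans (hW ⟨0, hm⟩)
  have hA : ∑ i, W i = s * u := by rw [hu]; field_simp
  have hB : ∑ i, W i ^ 2 = s ^ 2 * v := by rw [hv]; field_simp
  have hAB : 4 * K * |∑ i, W i| ≤ ∑ i, W i ^ 2 := by
    rw [hA, hB, abs_mul, abs_of_pos hs]
    calc 4 * K * (s * |u|) = s ^ 2 * (8 * (K / s) * |u| * (1 / 2)) := by field_simp; ring
      _ ≤ s ^ 2 * (1 * (1 / 2)) := by gcongr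
      _ ≤ s ^ 2 * v := by gcongr; linarith
  have hexp := hl.abs_two_mul_sum_log_sub_le hW hK (by rw [hB]; positivity) hAB
  rw [hA, hB] at hexp
  calc |-2 * Real.log (elRatio W) - u ^ 2 / v|
      = |2 * ∑ i, Real.log (1 + l * W i) - (s * u) ^ 2 / (s ^ 2 * v)| := by
        rw [log_elRatio hm hl, mul_pow, mul_div_mul_left _ _ (by positivity)]
        ring_nf
    _ ≤ 48 * K * |s * u| ^ 3 / (s ^ 2 * v) ^ 2 := hexp
    _ = 48 * (K / s) * |u| ^ 3 / v ^ 2 := by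
        rw [abs_mul, abs_of_pos hs]
        field_simp
    _ ≤ 48 * (K / s) * |u| ^ 3 / (1 / 2) ^ 2 := by gcongr
    _ = 192 * (K / s) * |u| ^ 3 := by ring

end Expansion

lemma tendstoInMeasure_of_tendstoInDistribution_const {Ω Ω' ι : Type*} [MeasurableSpace Ω]
    [MeasurableSpace Ω'] {P : Measure Ω} [IsProbabilityMeasure P] {P' : Measure Ω'}
    [IsProbabilityMeasure P'] {L : Filter ι} {Y : ι → Ω → ℝ} {c : ℝ}
    (h : TendstoInDistribution Y L (fun _ : Ω' => c) (fun _ => P) P') :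
    TendstoInMeasure P Y L fun _ => c := by
  rw [tendstoInMeasure_iff_norm]
  intro ε hε
  have hclosed : IsClosed {y : ℝ | ε ≤ ‖y - c‖} := isClosed_le continuous_const (by fun_prop)
  have hlimsup := ProbabilityMeasure.limsup_measure_closed_le_of_tendsto h.tendsto hclosed
  simp only [ProbabilityMeasure.coe_mk] at hlimsup
  have hlaw (i : ι) : P.map (Y i) {y : ℝ | ε ≤ ‖y - c‖} = P {ω | ε ≤ ‖Y i ω - c‖} :=
    Measure.map_apply_of_aemeasurable (h.forall_aemeasurable i) hclosed.measurableSet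
  have hlim : P'.map (fun _ => c) {y : ℝ | ε ≤ ‖y - c‖} = 0 := by
    rw [Measure.map_apply measurable_const hclosed.measurableSet]
    simp [hε.not_ge]
  simp only [hlaw, hlim] at hlimsup
  exact tendsto_of_le_liminf_of_limsup_le zero_le hlimsup

lemma tendstoInMeasure_of_integral_sq_sub_le {Ω : Type*} [MeasurableSpace Ω] {P : Measure Ω}
    [IsFiniteMeasure P] {Y : ℕ → Ω → ℝ} {Z : Ω → ℝ}
    (hint : ∀ᶠ n in atTop, Integrable (fun ω => (Y n ω - Z ω) ^ 2) P) {r : ℕ → ℝ}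
    (hle : ∀ᶠ n in atTop, ∫ ω, (Y n ω - Z ω) ^ 2 ∂P ≤ r n) (hr : Tendsto r atTop (nhds 0)) :
    TendstoInMeasure P Y atTop Z := by
  rw [tendstoInMeasure_iff_measureReal_norm]
  intro ε hε
  refine squeeze_zero' (.of_forall fun _ => measureReal_nonneg) ?_
    (by simpa using hr.div_const (ε ^ 2))
  filter_upwards [hint, hle] with n hn hn'
  have hmarkov := mul_meas_ge_le_integral_of_nonneg (ae_of_all P fun ω => sq_nonneg (Y n ω - Z ω))
    hn (ε ^ 2)
  rw [le_div_iff₀ (by positivity), mul_comm]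
  refine le_trans (mul_le_mul_of_nonneg_left (measureReal_mono fun ω hω => ?_) (sq_nonneg ε))
    (hmarkov.trans hn')
  simpa only [Set.mem_ofPred_eq, Real.norm_eq_abs, sq_abs] using pow_le_pow_left₀ hε.le hω 2

section Wilks

variable {Ω : Type*} [MeasurableSpace Ω] {P : Measure Ω} [IsProbabilityMeasure P] {m : ℕ → ℕ}
  {W : ∀ n, Ω → Fin (m n) → ℝ} {K s : ℕ → ℝ}

lemma tendstoInMeasure_log_elRatio_sub {Ω' : Type*} [MeasurableSpace Ω'] {P' : Measure Ω'}
    [IsProbabilityMeasure P'] {Z : Ω' → ℝ} (hm : ∀ n, 0 < m n)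
    (hW : ∀ᶠ n in atTop, ∀ ω, (∃ l, IsMultiplier (W n ω) l) ∧ ∀ i, |W n ω i| ≤ K n)
    (hs : ∀ᶠ n in atTop, 0 < s n) (hK : Tendsto (fun n => K n / s n) atTop (nhds 0))
    (hsum : TendstoInDistribution (fun n ω => (∑ i, W n ω i) / s n) atTop Z (fun _ => P) P')
    (hsum_sq : TendstoInMeasure P (fun n ω => (∑ i, W n ω i ^ 2) / s n ^ 2) atTop fun _ => 1) :
    TendstoInMeasure P (fun n ω => -2 * Real.log (elRatio (W n ω))
      - ((∑ i, W n ω i) / s n) ^ 2 / max ((∑ i, W n ω i ^ 2) / s n ^ 2) (1 / 2)) atTop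
      fun _ => 0 := by
  have hratio : TendstoInMeasure P (fun n (_ : Ω) => K n / s n) atTop fun _ => 0 :=
    tendstoInMeasure_of_tendsto_ae (fun _ => aestronglyMeasurable_const) (ae_of_all _ fun _ => hK)
  have herr : TendstoInMeasure P (fun n ω => K n / s n *
      (|(∑ i, W n ω i) / s n| + |(∑ i, W n ω i) / s n| ^ 3)) atTop fun _ => 0 :=
    tendstoInMeasure_of_tendstoInDistribution_const (P' := P') (by
      convert! hsum.continuous_comp_prodMk_of_tendstoInMeasure_const
        (g := fun p : ℝ × ℝ => p.2 * (|p.1| + |p.1| ^ 3)) (by fun_prop) hratio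
        fun _ => aemeasurable_const
      exact (zero_mul _).symm)
  rw [tendstoInMeasure_iff_measureReal_norm] at herr hsum_sq ⊢
  intro ε hε
  refine squeeze_zero' (.of_forall fun _ => measureReal_nonneg) ?_ (by
    simpa only [add_zero] using
      (hsum_sq (1 / 2) (by norm_num)).add (herr (min (1 / 8) (ε / 384)) (by positivity)))
  filter_upwards [hW, hs] with n hWn hsn
  refine (measureReal_mono fun ω hω => ?_).trans (measureReal_union_le _ _)
  by_contra hcompl
  simp only [Set.mem_union, Set.mem_ofPred_eq, not_or, not_le] at hcompl
  obtain ⟨hv, herr_lt⟩ := hcompl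
  obtain ⟨⟨l, hl⟩, hWK⟩ := hWn ω
  obtain ⟨u, hu⟩ : ∃ u, u = (∑ i, W n ω i) / s n := ⟨_, rfl⟩
  obtain ⟨v, hv_eq⟩ : ∃ v, v = (∑ i, W n ω i ^ 2) / s n ^ 2 := ⟨_, rfl⟩
  have hκ : 0 ≤ K n / s n := div_nonneg ((abs_nonneg _).trans (hWK ⟨0, hm n⟩)) hsn.le
  simp only [Set.mem_ofPred_eq, sub_zero, Real.norm_eq_abs, ← hu, ← hv_eq] at hω hv herr_lt
  have hv_half : 1 / 2 ≤ v := by linarith [(abs_lt.1 hv).1]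
  obtain ⟨hsmall, hsmall'⟩ := lt_min_iff.1 ((le_abs_self _).trans_lt herr_lt)
  have hexp := hl.abs_neg_two_mul_log_elRatio_sub_le (hm n) hWK hsn hu hv_eq hv_half (by
    nlinarith [mul_nonneg hκ (pow_nonneg (abs_nonneg u) 3)])
  rw [max_eq_left hv_half] at hω
  nlinarith [mul_nonneg hκ (abs_nonneg u)]

theorem tendstoInDistribution_neg_two_mul_log_elRatio {Ω' : Type*} [MeasurableSpace Ω']
    {P' : Measure Ω'} [IsProbabilityMeasure P'] {Z : Ω' → ℝ} (hm : ∀ n, 0 < m n)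
    (hW : ∀ᶠ n in atTop, ∀ ω, (∃ l, IsMultiplier (W n ω) l) ∧ ∀ i, |W n ω i| ≤ K n)
    (hs : ∀ᶠ n in atTop, 0 < s n) (hK : Tendsto (fun n => K n / s n) atTop (nhds 0))
    (hsum : TendstoInDistribution (fun n ω => (∑ i, W n ω i) / s n) atTop Z (fun _ => P) P')
    (hsum_sq : TendstoInMeasure P (fun n ω => (∑ i, W n ω i ^ 2) / s n ^ 2) atTop fun _ => 1)
    (hsum_sq_meas : ∀ n, AEMeasurable (fun ω => ∑ i, W n ω i ^ 2) P)
    (hmeas : ∀ n, AEMeasurable (fun ω => elRatio (W n ω)) P) :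
    TendstoInDistribution (fun n ω => -2 * Real.log (elRatio (W n ω))) atTop (fun ω => Z ω ^ 2)
      (fun _ => P) P' := by
  have hquad := hsum.continuous_comp_prodMk_of_tendstoInMeasure_const
    (g := fun p : ℝ × ℝ => p.1 ^ 2 / max p.2 (1 / 2))
    (by fun_prop (disch := intro p; positivity)) hsum_sq fun n => (hsum_sq_meas n).div_const _
  have hmax : max (1 : ℝ) (1 / 2) = 1 := max_eq_left (by norm_num)
  simp only [hmax, div_one] at hquad
  refine tendstoInDistribution_of_tendstoInMeasure_sub _ _ hquad
    (tendstoInMeasure_log_elRatio_sub hm hW hs hK hsum hsum_sq) fun n => ?_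
  exact (Real.measurable_log.comp_aemeasurable (hmeas n)).const_mul _

end Wilks

/-! ### A central limit theorem for bounded triangular arrays -/

lemma norm_prod_sub_prod_le {ι R : Type*} [NormedCommRing R] [NormOneClass R] (s : Finset ι)
    {u v : ι → R} (hu : ∀ i ∈ s, ‖u i‖ ≤ 1) (hv : ∀ i ∈ s, ‖v i‖ ≤ 1) :
    ‖∏ i ∈ s, u i - ∏ i ∈ s, v i‖ ≤ ∑ i ∈ s, ‖u i - v i‖ := by
  classical
  induction s using Finset.induction_on with
  | empty => simp
  | insert a s ha ih =>
    simp only [Finset.forall_mem_insert] at hu hv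
    rw [Finset.prod_insert ha, Finset.prod_insert ha, Finset.sum_insert ha]
    have hprod : ‖∏ i ∈ s, u i‖ ≤ 1 := (Finset.norm_prod_le _ _).trans
      (Finset.prod_le_one (fun i _ => norm_nonneg _) hu.2)
    calc ‖u a * ∏ i ∈ s, u i - v a * ∏ i ∈ s, v i‖
        = ‖(u a - v a) * ∏ i ∈ s, u i + v a * (∏ i ∈ s, u i - ∏ i ∈ s, v i)‖ := by ring_nf
      _ ≤ ‖u a - v a‖ * ‖∏ i ∈ s, u i‖ + ‖v a‖ * ‖∏ i ∈ s, u i - ∏ i ∈ s, v i‖ :=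
          (norm_add_le _ _).trans (add_le_add (norm_mul_le _ _) (norm_mul_le _ _))
      _ ≤ ‖u a - v a‖ * 1 + 1 * ∑ i ∈ s, ‖u i - v i‖ := by
          gcongr
          exacts [hv.1, ih hu.2 hv.2]
      _ = ‖u a - v a‖ + ∑ i ∈ s, ‖u i - v i‖ := by ring

lemma norm_exp_mul_I_sub_le {y : ℝ} (hy : |y| ≤ 1) :
    ‖Complex.exp (y * Complex.I) - (1 + y * Complex.I - ((y ^ 2 / 2 : ℝ) : ℂ))‖ ≤ |y| ^ 3 := by
  have hnorm : ‖(y : ℂ) * Complex.I‖ = |y| := by simp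
  have hbound := Complex.exp_bound (x := y * Complex.I) (hnorm.trans_le hy) (n := 3) (by norm_num)
  have hsum : ∑ m ∈ Finset.range 3, ((y : ℂ) * Complex.I) ^ m / (m.factorial : ℂ)
      = 1 + y * Complex.I - ((y ^ 2 / 2 : ℝ) : ℂ) := by
    simp only [Finset.sum_range_succ, Finset.sum_range_zero, mul_pow, Complex.I_sq]
    norm_num [Nat.factorial]
    ring
  rw [hnorm, hsum] at hbound
  refine hbound.trans ?_
  norm_num [Nat.factorial]
  nlinarith [pow_nonneg (abs_nonneg y) 3]

section CharFun

variable {α : Type*} [MeasurableSpace α] {μ : Measure α} [IsProbabilityMeasure μ] {f : α → ℝ}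
  {β : ℝ}

lemma norm_integral_exp_mul_I_sub_le (hf : BddMeas f) (hmean : ∫ a, f a ∂μ = 0)
    (hβ : ∀ a, |f a| ≤ β) (hβ1 : β ≤ 1) :
    ‖∫ a, Complex.exp (f a * Complex.I) ∂μ - ((1 - (∫ a, f a ^ 2 ∂μ) / 2 : ℝ) : ℂ)‖
      ≤ β * ∫ a, f a ^ 2 ∂μ := by
  have hlin : Integrable (fun a => (f a : ℂ) * Complex.I) μ :=
    (hf.integrable μ).ofReal.mul_const _
  have hquad : Integrable (fun a => ((f a ^ 2 / 2 : ℝ) : ℂ)) μ :=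
    ((hf.sq.integrable μ).div_const 2).ofReal
  have haff : Integrable (fun a => 1 + (f a : ℂ) * Complex.I) μ := (integrable_const _).add hlin
  have hexp : Integrable (fun a => Complex.exp (f a * Complex.I)) μ := by
    have := hf.1
    exact .of_bound (by fun_prop) 1
      (ae_of_all _ fun a => (Complex.norm_exp_ofReal_mul_I _).le)
  have htaylor : ∫ a, (1 + (f a : ℂ) * Complex.I - ((f a ^ 2 / 2 : ℝ) : ℂ)) ∂μ
      = ((1 - (∫ a, f a ^ 2 ∂μ) / 2 : ℝ) : ℂ) := by
    rw [integral_sub haff hquad, integral_add (integrable_const _) hlin, integral_mul_const,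
      integral_complex_ofReal, integral_complex_ofReal, hmean, integral_div]
    simp
  have hpoly : Integrable (fun a => 1 + (f a : ℂ) * Complex.I - ((f a ^ 2 / 2 : ℝ) : ℂ)) μ :=
    haff.sub hquad
  rw [← htaylor, ← integral_sub hexp hpoly, ← integral_const_mul]
  refine norm_integral_le_of_norm_le ((hf.sq.const_mul β).integrable μ) (ae_of_all _ fun a => ?_)
  refine (norm_exp_mul_I_sub_le ((hβ a).trans hβ1)).trans ?_
  rw [pow_succ, sq_abs, mul_comm]
  exact mul_le_mul_of_nonneg_right (hβ a) (sq_nonneg _)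

lemma norm_integral_exp_mul_I_sub_exp_le (hf : BddMeas f) (hmean : ∫ a, f a ∂μ = 0)
    (hβ : ∀ a, |f a| ≤ β) (hβ1 : β ≤ 1) :
    ‖∫ a, Complex.exp (f a * Complex.I) ∂μ - ((Real.exp (-((∫ a, f a ^ 2 ∂μ) / 2)) : ℝ) : ℂ)‖
      ≤ 2 * β * ∫ a, f a ^ 2 ∂μ := by
  have htaylor := norm_integral_exp_mul_I_sub_le hf hmean hβ hβ1
  have hvβ := hf.integral_sq_le_of_abs_le μ hβ
  set v := ∫ a, f a ^ 2 ∂μ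
  have hv0 : 0 ≤ v := integral_nonneg fun a => sq_nonneg _
  obtain ⟨a⟩ := nonempty_of_isProbabilityMeasure μ
  have hβ0 : 0 ≤ β := (abs_nonneg _).trans (hβ a)
  have hv1 : v ≤ β := hvβ.trans (by nlinarith)
  have hexp : ‖((1 - v / 2 : ℝ) : ℂ) - (Real.exp (-(v / 2)) : ℝ)‖ ≤ β * v := by
    rw [← Complex.ofReal_sub, Complex.norm_real, Real.norm_eq_abs, abs_sub_comm]
    have h := Real.norm_exp_sub_one_sub_id_le (x := -(v / 2))
      (by rw [Real.norm_eq_abs, abs_neg, abs_of_nonneg (by positivity)]; linarith)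
    calc |Real.exp (-(v / 2)) - (1 - v / 2)| = ‖Real.exp (-(v / 2)) - 1 - -(v / 2)‖ := by
          rw [Real.norm_eq_abs]; ring_nf
      _ ≤ ‖-(v / 2)‖ ^ 2 := h
      _ = v * v / 4 := by rw [norm_neg, Real.norm_eq_abs, sq_abs]; ring
      _ ≤ β * v := by nlinarith
  calc _ ≤ _ := norm_sub_le_norm_sub_add_norm_sub _ ((1 - v / 2 : ℝ) : ℂ) _
    _ ≤ β * v + β * v := add_le_add htaylor hexp
    _ = 2 * β * v := by ring

lemma norm_charFun_map_sub_exp_le (hf : BddMeas f) (hmean : ∫ a, f a ∂μ = 0)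
    (hβ : ∀ a, |f a| ≤ β) {t : ℝ} (ht : |t| * β ≤ 1) :
    ‖charFun (μ.map f) t - ((Real.exp (-(t ^ 2 * (∫ a, f a ^ 2 ∂μ) / 2)) : ℝ) : ℂ)‖
      ≤ 2 * |t| ^ 3 * β * ∫ a, f a ^ 2 ∂μ := by
  have hchar : charFun (μ.map f) t = ∫ a, Complex.exp ((t * f a : ℝ) * Complex.I) ∂μ := by
    rw [charFun_apply_real, integral_map hf.1.aemeasurable
      (by fun_prop : Measurable fun y : ℝ => Complex.exp (t * y * Complex.I)).aestronglyMeasurable]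
    simp only [Complex.ofReal_mul]
  have hbound := norm_integral_exp_mul_I_sub_exp_le (μ := μ) (hf.const_mul t)
    (by rw [integral_const_mul, hmean, mul_zero])
    (fun a => (abs_mul _ _).trans_le (mul_le_mul_of_nonneg_left (hβ a) (abs_nonneg t))) ht
  simp only [mul_pow, integral_const_mul] at hbound
  rw [hchar]
  refine hbound.trans_eq ?_
  rw [← sq_abs t]
  ring

end CharFun

section CentralLimit

variable {Ω ι : Type*} [MeasurableSpace Ω] {P : Measure Ω} [IsProbabilityMeasure P]

lemma norm_charFun_map_sum_sub_le {s : Finset ι} {Y : ι → Ω → ℝ}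
    (hindep : iIndepFun Y P) (hY : ∀ i, BddMeas (Y i)) (hmean : ∀ i, ∫ ω, Y i ω ∂P = 0) {β : ℝ}
    (hβ : ∀ i ∈ s, ∀ ω, |Y i ω| ≤ β) {t : ℝ} (ht : |t| * β ≤ 1) :
    ‖charFun (P.map fun ω => ∑ i ∈ s, Y i ω) t
        - ((Real.exp (-(t ^ 2 * (∑ i ∈ s, ∫ ω, Y i ω ^ 2 ∂P) / 2)) : ℝ) : ℂ)‖
      ≤ 2 * |t| ^ 3 * β * ∑ i ∈ s, ∫ ω, Y i ω ^ 2 ∂P := by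
  have hexp : ((Real.exp (-(t ^ 2 * (∑ i ∈ s, ∫ ω, Y i ω ^ 2 ∂P) / 2)) : ℝ) : ℂ)
      = ∏ i ∈ s, ((Real.exp (-(t ^ 2 * (∫ ω, Y i ω ^ 2 ∂P) / 2)) : ℝ) : ℂ) := by
    rw [← Complex.ofReal_prod, ← Real.exp_sum, Finset.sum_neg_distrib, ← Finset.sum_div,
      ← Finset.mul_sum]
  rw [(hindep.restrict s).charFun_map_fun_finsetSum_eq_prod fun i _ => (hY i).1.aemeasurable,
    Finset.prod_apply, hexp, Finset.mul_sum]
  refine (norm_prod_sub_prod_le s (fun i _ => ?_) fun i _ => ?_).trans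
    (Finset.sum_le_sum fun i hi => norm_charFun_map_sub_exp_le (hY i) (hmean i) (hβ i hi) ht)
  · have := Measure.isProbabilityMeasure_map (μ := P) (hY i).1.aemeasurable
    exact norm_charFun_le_one t
  · rw [Complex.norm_real, Real.norm_eq_abs, Real.abs_exp, Real.exp_le_one_iff, neg_nonpos]
    have : 0 ≤ ∫ ω, Y i ω ^ 2 ∂P := integral_nonneg fun ω => sq_nonneg _
    positivity

theorem tendstoInDistribution_sum_of_tendsto_bound {s : ℕ → Finset ι} {Y : ℕ → ι → Ω → ℝ}
    (hindep : ∀ n, iIndepFun (Y n) P) (hY : ∀ n i, BddMeas (Y n i))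
    (hmean : ∀ n i, ∫ ω, Y n i ω ∂P = 0)
    {β : ℕ → ℝ} (hβ : ∀ᶠ n in atTop, ∀ i ∈ s n, ∀ ω, |Y n i ω| ≤ β n)
    (hβ0 : Tendsto β atTop (nhds 0))
    (hvar : ∀ᶠ n in atTop, ∑ i ∈ s n, ∫ ω, Y n i ω ^ 2 ∂P = 1) :
    TendstoInDistribution (fun n ω => ∑ i ∈ s n, Y n i ω) atTop (id : ℝ → ℝ) (fun _ => P)
      (gaussianReal 0 1) := by
  refine ⟨fun n => (Finset.measurable_sum _ fun i _ => (hY n i).1).aemeasurable, aemeasurable_id,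
    ProbabilityMeasure.tendsto_iff_tendsto_charFun.2 fun t => ?_⟩
  simp only [ProbabilityMeasure.coe_mk, Measure.map_id]
  rw [charFun_gaussianReal, tendsto_iff_norm_sub_tendsto_zero]
  have hsmall : ∀ᶠ n in atTop, |t| * β n ≤ 1 :=
    Tendsto.eventually_le_const one_pos (by simpa using hβ0.const_mul |t|)
  refine squeeze_zero' (.of_forall fun n => norm_nonneg _) ?_
    (by simpa using hβ0.const_mul (2 * |t| ^ 3))
  filter_upwards [hβ, hvar, hsmall] with n hβn hn hs
  have hbound := norm_charFun_map_sum_sub_le (hindep n) (hY n) (hmean n) hβn hs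
  have hgauss : Complex.exp (t * (0 : ℝ) * Complex.I - (1 : NNReal) * t ^ 2 / 2)
      = ((Real.exp (-(t ^ 2 * 1 / 2)) : ℝ) : ℂ) := by
    push_cast
    ring_nf
  rw [hn, ← hgauss] at hbound
  exact hbound.trans_eq (by ring)

end CentralLimit

/-! ### Hájek projections -/

section SumEval

variable {ι : Type*} {α : ι → Type*} {s : Finset ι}

lemma dependsOn_sum_eval (f : ∀ i, α i → ℝ) : DependsOn (fun x => ∑ i ∈ s, f i (x i)) s :=
  fun x y hxy => Finset.sum_congr rfl fun i hi => by rw [hxy i hi]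

lemma sum_eval_sub_update [DecidableEq ι] {i : ι} (hi : i ∈ s) (f : ∀ j, α j → ℝ)
    (x : ∀ j, α j) (a : α i) :
    ∑ j ∈ s, f j (x j) - ∑ j ∈ s, f j (Function.update x i a j) = f i (x i) - f i a := by
  rw [← Finset.sum_sub_distrib, Finset.sum_eq_single_of_mem i hi fun j _ hji => by
    rw [Function.update_of_ne hji, sub_self], Function.update_self]

variable [∀ i, MeasurableSpace (α i)] (μ : ∀ i, Measure (α i)) [∀ i, IsProbabilityMeasure (μ i)]

lemma integral_eval_infinitePi {i : ι} {f : α i → ℝ} (hf : BddMeas f) :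
    ∫ x, f (x i) ∂Measure.infinitePi μ = ∫ a, f a ∂μ i := by
  rw [← (measurePreserving_eval_infinitePi μ i).map_eq,
    integral_map (measurable_pi_apply i).aemeasurable hf.1.aestronglyMeasurable]

lemma variance_sum_eval_le {f : ∀ i, α i → ℝ} (hf : ∀ i, BddMeas (f i)) {c : ℝ}
    (h : ∀ i ∈ s, ∀ a b, |f i a - f i b| ≤ c) :
    variance (fun x => ∑ i ∈ s, f i (x i)) (Measure.infinitePi μ) ≤ s.card * c ^ 2 := by
  classical
  have hF : BddMeas fun x : ∀ j, α j => ∑ i ∈ s, f i (x i) :=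
    BddMeas.sum fun i _ => (hf i).comp (measurable_pi_apply i)
  refine (variance_le_sum_influence μ s hF (dependsOn_sum_eval f)).trans ?_
  rw [← nsmul_eq_mul]
  refine Finset.sum_le_card_nsmul s _ _ fun i hi => influence_le μ hF fun x a => ?_
  rw [sum_eval_sub_update hi]
  exact h i hi _ _

end SumEval

section HajekProjection

variable {ι : Type*} [DecidableEq ι] {α : ι → Type*} {s : Finset ι}

lemma dependsOn_update {F : (∀ j, α j) → ℝ} {s : Set ι} (hs : DependsOn F s) (i : ι) (a : α i) :
    DependsOn (fun x => F (Function.update x i a)) s := by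
  intro x y hxy
  refine hs fun j hj => ?_
  by_cases hji : j = i
  · subst hji; simp
  · simp [Function.update_of_ne hji, hxy j hj]

variable [∀ i, MeasurableSpace (α i)] (μ : ∀ i, Measure (α i))

/-- The Hájek projection of `F` onto the `i`-th coordinate: the conditional expectation of `F`
given that coordinate. -/
noncomputable def hajekProj (i : ι) (F : (∀ j, α j) → ℝ) (a : α i) : ℝ :=
  ∫ x, F (Function.update x i a) ∂Measure.infinitePi μ

variable {F : (∀ j, α j) → ℝ} {i : ι}

lemma influence_congr {G : (∀ j, α j) → ℝ}
    (h : ∀ x a, F x - F (Function.update x i a) = G x - G (Function.update x i a)) :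
    influence μ F i = influence μ G i := by
  simp only [influence, h]

variable [∀ i, IsProbabilityMeasure (μ i)]

lemma BddMeas.hajekProj (hF : BddMeas F) (i : ι) : BddMeas (hajekProj μ i F) :=
  ((hF.update i).comp measurable_swap).integral_right (Measure.infinitePi μ)

lemma abs_hajekProj_le {c : ℝ} (h : ∀ x, |F x| ≤ c) (a : α i) : |hajekProj μ i F a| ≤ c := by
  simpa [CauchyAJEL.hajekProj] using norm_integral_le_of_norm_le_const (μ := Measure.infinitePi μ)
    (f := fun x => F (Function.update x i a)) (ae_of_all _ fun x => h _)

lemma integral_integral_update (hF : BddMeas F) (i : ι) :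
    ∫ a, ∫ x, F (Function.update x i a) ∂Measure.infinitePi μ ∂μ i
      = ∫ x, F x ∂Measure.infinitePi μ := by
  rw [← integral_coordAverage μ i (hF.integrable _)]
  exact integral_integral_swap
    (((hF.update i).comp measurable_swap).integrable ((μ i).prod (Measure.infinitePi μ)))

lemma integral_sub_hajekProj_sq_le (hF : BddMeas F) (hs : DependsOn F s) {c : ℝ}
    (h : ∀ j ∈ s, j ≠ i → ∀ x b, |F x - F (Function.update x j b)| ≤ c) :
    ∫ x, (F x - hajekProj μ i F (x i)) ^ 2 ∂Measure.infinitePi μ ≤ s.card * c ^ 2 := by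
  have hD : BddMeas fun x => F x - hajekProj μ i F (x i) :=
    hF.sub ((hF.hajekProj μ i).comp (measurable_pi_apply i))
  rw [← integral_integral_update μ hD.sq i]
  simp only [Function.update_self]
  have hfix (a : α i) : ∫ x, (F (Function.update x i a) - hajekProj μ i F a) ^ 2
      ∂Measure.infinitePi μ ≤ s.card * c ^ 2 := by
    have hFa : BddMeas fun x => F (Function.update x i a) :=
      hF.comp measurable_update_left
    have hinfluence : ∀ j ∈ s, influence μ (fun x => F (Function.update x i a)) j ≤ c ^ 2 := by
      refine fun j hj => ?_
      rcases eq_or_ne j i with rfl | hji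
      · simpa [influence] using sq_nonneg c
      · refine influence_le μ hFa fun x b => ?_
        rw [Function.update_comm hji]
        exact h j hj hji _ b
    calc _ = variance (fun x => F (Function.update x i a)) (Measure.infinitePi μ) :=
          (variance_eq_integral hFa.1.aemeasurable).symm
      _ ≤ ∑ j ∈ s, influence μ (fun x => F (Function.update x i a)) j :=
          variance_le_sum_influence μ s hFa (dependsOn_update hs i a)
      _ ≤ s.card * c ^ 2 := by simpa using Finset.sum_le_card_nsmul s _ _ hinfluence
  have hint : BddMeas fun a => ∫ x, (F (Function.update x i a) - hajekProj μ i F a) ^ 2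
      ∂Measure.infinitePi μ :=
    (((hF.update i).comp measurable_swap).sub
      ((hF.hajekProj μ i).comp measurable_fst)).sq.integral_right _
  exact (integral_mono (hint.integrable _) (integrable_const _) hfix).trans (by simp)

lemma influence_le_four_mul_integral_sq (hF : BddMeas F) (i : ι) :
    influence μ F i ≤ 4 * ∫ x, F x ^ 2 ∂Measure.infinitePi μ := by
  have hsum : BddMeas fun p : (∀ j, α j) × α i =>
      2 * F p.1 ^ 2 + 2 * F (Function.update p.1 i p.2) ^ 2 :=
    ((hF.comp measurable_fst).sq.const_mul 2).add ((hF.update i).sq.const_mul 2)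
  calc influence μ F i
      ≤ ∫ x, ∫ a, (2 * F x ^ 2 + 2 * F (Function.update x i a) ^ 2) ∂μ i ∂Measure.infinitePi μ := by
        refine integral_mono (((hF.sub_update_sq i).integral_right _).integrable _)
          ((hsum.integral_right _).integrable _) fun x => ?_
        refine integral_mono (((BddMeas.const _).sub (hF.update_right i x)).sq.integrable _)
          (((BddMeas.const _).add ((hF.update_right i x).sq.const_mul 2)).integrable _) fun a => ?_
        nlinarith [sq_nonneg (F x + F (Function.update x i a))]
    _ = ∫ x, (2 * F x ^ 2 + 2 * coordAverage μ i (fun x => F x ^ 2) x) ∂Measure.infinitePi μ := by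
        refine integral_congr_ae (ae_of_all _ fun x => ?_)
        beta_reduce
        rw [integral_add (integrable_const _)
            (((hF.update_right i x).sq.const_mul 2).integrable (μ i)), integral_const,
          integral_const_mul, probReal_univ, one_smul, coordAverage]
    _ = 4 * ∫ x, F x ^ 2 ∂Measure.infinitePi μ := by
        rw [integral_add ((hF.sq.const_mul 2).integrable _)
          (((hF.sq.coordAverage μ i).const_mul 2).integrable _), integral_const_mul,
          integral_const_mul, integral_coordAverage μ i (hF.sq.integrable _)]
        ring

/- If replacing the `i`-th coordinate changes `S` and `J i` by the same amount, then it changes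
`S - ∑ i, hajekProj μ i (J i)` and `J i - hajekProj μ i (J i)` by the same amount. -/
lemma variance_sub_sum_hajekProj_le {S : (∀ j, α j) → ℝ} {J : ι → (∀ j, α j) → ℝ}
    (hS : BddMeas S) (hs : DependsOn S s) (hJ : ∀ i, BddMeas (J i))
    (h : ∀ i ∈ s, ∀ x a, S x - S (Function.update x i a) = J i x - J i (Function.update x i a)) :
    variance (fun x => S x - ∑ i ∈ s, hajekProj μ i (J i) (x i)) (Measure.infinitePi μ)
      ≤ 4 * ∑ i ∈ s, ∫ x, (J i x - hajekProj μ i (J i) (x i)) ^ 2 ∂Measure.infinitePi μ := by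
  have hproj (i) : BddMeas fun x : ∀ j, α j => hajekProj μ i (J i) (x i) :=
    ((hJ i).hajekProj μ i).comp (measurable_pi_apply i)
  have hdep : DependsOn (fun x : ∀ j, α j => S x - ∑ i ∈ s, hajekProj μ i (J i) (x i)) s :=
    fun x y hxy =>
      congrArg₂ (· - ·) (hs hxy) (dependsOn_sum_eval (fun i => hajekProj μ i (J i)) hxy)
  refine (variance_le_sum_influence μ s (hS.sub (BddMeas.sum fun i _ => hproj i)) hdep).trans ?_
  rw [Finset.mul_sum]
  refine Finset.sum_le_sum fun i hi => ?_
  refine (influence_congr μ fun x a => ?_).trans_le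
    (influence_le_four_mul_integral_sq μ ((hJ i).sub (hproj i)) i)
  have hsum := sum_eval_sub_update hi (fun i => hajekProj μ i (J i)) x a
  rw [Function.update_self]
  linarith [h i hi x a]

end HajekProjection

/-! ### Triples of indices -/

section Triples

open scoped Finset

variable {ι : Type*} [LinearOrder ι] {s : Finset ι} {i j : ι}

/-- The triples `i > j > k` of elements of `s`, over which a statistic with a kernel of degree
three sums. -/
def triples (s : Finset ι) : Finset (ι × ι × ι) :=
  {t ∈ s ×ˢ s ×ˢ s | t.2.1 < t.1 ∧ t.2.2 < t.2.1}

/-- The triple `t` contains the index `i`. -/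
def Occurs (i : ι) (t : ι × ι × ι) : Prop := i = t.1 ∨ i = t.2.1 ∨ i = t.2.2

instance (i : ι) (t : ι × ι × ι) : Decidable (Occurs i t) :=
  inferInstanceAs (Decidable (_ ∨ _ ∨ _))

lemma mem_triples {t : ι × ι × ι} :
    t ∈ triples s ↔ (t.1 ∈ s ∧ t.2.1 ∈ s ∧ t.2.2 ∈ s) ∧ t.2.1 < t.1 ∧ t.2.2 < t.2.1 := by
  simp [triples]

lemma sum_triples {M : Type*} [AddCommMonoid M] (s : Finset ι) (f : ι → ι → ι → M) :
    ∑ t ∈ triples s, f t.1 t.2.1 t.2.2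
      = ∑ i ∈ s, ∑ j ∈ s with j < i, ∑ k ∈ s with k < j, f i j k := by
  simp only [triples, Finset.sum_filter, Finset.sum_product]
  refine Finset.sum_congr rfl fun i _ => Finset.sum_congr rfl fun j _ => ?_
  split_ifs with hji <;> simp [hji]

lemma triples_erase (s : Finset ι) (i : ι) :
    triples (s.erase i) = {t ∈ triples s | ¬Occurs i t} := by
  ext t
  rw [Finset.mem_filter, mem_triples, mem_triples]
  simp only [Occurs, Finset.mem_erase, ne_comm (b := i)]
  tauto

lemma card_filter_occurs_of_mem {t : ι × ι × ι} (ht : t ∈ triples s) :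
    #{i ∈ s | Occurs i t} = 3 := by
  obtain ⟨⟨h₁, h₂, h₃⟩, h₂₁, h₃₂⟩ := mem_triples.1 ht
  have hs : {i ∈ s | Occurs i t} = {t.1, t.2.1, t.2.2} := by
    ext i
    rw [Finset.mem_filter]
    simp only [Finset.mem_insert, Finset.mem_singleton, Occurs]
    refine ⟨And.right, fun h => ⟨?_, h⟩⟩
    rcases h with rfl | rfl | rfl <;> assumption
  rw [hs, Finset.card_eq_three]
  exact ⟨_, _, _, h₂₁.ne', (h₃₂.trans h₂₁).ne', h₃₂.ne', rfl⟩

lemma sum_card_filter_lt {M : Type*} [AddCommMonoid M] (f : ℕ → M) (s : Finset ι) :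
    ∑ i ∈ s, f #{j ∈ s | j < i} = ∑ m ∈ Finset.range #s, f m := by
  induction s using Finset.induction_on_max with
  | empty => simp
  | insert a s ha ih =>
    have has : a ∉ s := fun h => lt_irrefl _ (ha a h)
    have hbelow : {j ∈ insert a s | j < a} = s := by
      rw [Finset.filter_insert, if_neg (lt_irrefl a), Finset.filter_true_of_mem ha]
    rw [Finset.sum_insert has, hbelow, Finset.card_insert_of_notMem has, Finset.sum_range_succ,
      add_comm, ← ih]
    refine congrArg (· + _) (Finset.sum_congr rfl fun i hi => ?_)
    rw [Finset.filter_insert, if_neg (ha i hi).not_gt]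

lemma sum_card_filter_gt {M : Type*} [AddCommMonoid M] (f : ℕ → M) (s : Finset ι) :
    ∑ i ∈ s, f #{j ∈ s | i < j} = ∑ m ∈ Finset.range #s, f m :=
  sum_card_filter_lt (ι := ιᵒᵈ) f s

lemma sum_range_choose_eq (n k : ℕ) :
    ∑ m ∈ Finset.range n, m.choose k = n.choose (k + 1) := by
  induction n with
  | zero => simp
  | succ n ih => rw [Finset.sum_range_succ, ih, Nat.choose_succ_succ, add_comm]

lemma card_filter_snd_lt_fst (s : Finset ι) :
    #{p ∈ s ×ˢ s | p.2 < p.1} = (#s).choose 2 := by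
  rw [Finset.card_filter, Finset.sum_product, ← sum_range_choose_eq, ← sum_card_filter_lt]
  simp

lemma card_filter_fst_eq (hi : i ∈ s) :
    #{t ∈ triples s | t.1 = i} = (#{j ∈ s | j < i}).choose 2 := by
  rw [← card_filter_snd_lt_fst]
  refine Finset.card_nbij' Prod.snd (fun p => (i, p)) ?_ ?_ ?_ ?_ <;> intro t <;>
    simp only [Finset.mem_coe, Finset.mem_filter, mem_triples, Finset.mem_product] <;> grind

lemma card_filter_snd_snd_eq (hi : i ∈ s) :
    #{t ∈ triples s | t.2.2 = i} = (#{j ∈ s | i < j}).choose 2 := by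
  rw [← card_filter_snd_lt_fst]
  refine Finset.card_nbij' (fun t => (t.1, t.2.1)) (fun p => (p.1, p.2, i)) ?_ ?_ ?_ ?_ <;>
    intro t <;>
    simp only [Finset.mem_coe, Finset.mem_filter, mem_triples, Finset.mem_product] <;> grind

lemma card_triples (s : Finset ι) : #(triples s) = (#s).choose 3 := by
  rw [Finset.card_eq_sum_card_fiberwise fun t ht => (mem_triples.1 ht).1.1,
    Finset.sum_congr rfl fun i hi => card_filter_fst_eq hi, sum_card_filter_lt fun m => m.choose 2,
    sum_range_choose_eq]

lemma card_filter_occurs (hi : i ∈ s) :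
    #{t ∈ triples s | Occurs i t} = (#s - 1).choose 2 := by
  have hsplit := Finset.card_filter_add_card_filter_not (s := triples s) (Occurs i)
  rw [← triples_erase, card_triples, card_triples, Finset.card_erase_of_mem hi] at hsplit
  obtain ⟨m, hm⟩ := Nat.exists_eq_succ_of_ne_zero (Finset.card_ne_zero_of_mem hi)
  rw [hm, Nat.choose_succ_succ] at hsplit
  simpa [hm] using hsplit

lemma card_filter_occurs_and_occurs (hi : i ∈ s) (hj : j ∈ s) (hij : i ≠ j) :
    #{t ∈ triples s | Occurs i t ∧ Occurs j t} = #s - 2 := by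
  have hsplit := Finset.card_filter_add_card_filter_not (s := {t ∈ triples s | Occurs i t})
    (Occurs j)
  rw [Finset.filter_filter, Finset.filter_comm (p := Occurs i), ← triples_erase,
    card_filter_occurs hi, card_filter_occurs (Finset.mem_erase.2 ⟨hij, hi⟩),
    Finset.card_erase_of_mem hj] at hsplit
  obtain ⟨m, hm⟩ : ∃ m, #s = m + 2 :=
    Nat.exists_eq_add_of_le' (Finset.one_lt_card.2 ⟨i, hi, j, hj, hij⟩)
  rw [hm] at hsplit ⊢
  rw [show m + 2 - 1 = m + 1 from rfl, show m + 1 - 1 = m from rfl, Nat.choose_succ_succ m 1,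
    Nat.choose_one_right] at hsplit
  exact Nat.add_right_cancel hsplit

end Triples

/-! ### Jackknifing a U-statistic of degree three -/

section UStatistic

open scoped Finset

variable {ι α : Type*} {κ : α → α → α → ℝ} {s : Finset ι} {i j : ι}

/-- A kernel at the observations with indices `t`. -/
def kernelAt (κ : α → α → α → ℝ) (x : ι → α) (t : ι × ι × ι) : ℝ := κ (x t.1) (x t.2.1) (x t.2.2)

lemma abs_sum_kernelAt_le (hκ : ∀ a b c, |κ a b c| ≤ 1) (T : Finset (ι × ι × ι)) (x : ι → α) :
    |∑ t ∈ T, kernelAt κ x t| ≤ #T :=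
  (Finset.abs_sum_le_sum_abs _ _).trans
    ((Finset.sum_le_card_nsmul T _ 1 fun _ _ => hκ _ _ _).trans (by simp))

variable [LinearOrder ι]

/-- The sum of a kernel over the triples of the sample `x i`, `i ∈ s`. -/
def tripleSum (κ : α → α → α → ℝ) (s : Finset ι) (x : ι → α) : ℝ := ∑ t ∈ triples s, kernelAt κ x t

/-- The part of `tripleSum` which involves the `i`-th observation. -/
def occurSum (κ : α → α → α → ℝ) (s : Finset ι) (i : ι) (x : ι → α) : ℝ :=
  ∑ t ∈ triples s with Occurs i t, kernelAt κ x t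

/-- The U-statistic of the sample `x i`, `i ∈ s`, whose kernel need not be symmetric. -/
noncomputable def uStat (κ : α → α → α → ℝ) (s : Finset ι) (x : ι → α) : ℝ :=
  (((#s).choose 3 : ℕ) : ℝ)⁻¹ * tripleSum κ s x

/-- The jackknife pseudo-values of `uStat`. -/
noncomputable def jackknife (κ : α → α → α → ℝ) (s : Finset ι) (i : ι) (x : ι → α) : ℝ :=
  #s * uStat κ s x - (#s - 1) * uStat κ (s.erase i) x

lemma kernelAt_update {t : ι × ι × ι} (ht : ¬Occurs i t) (x : ι → α) (a : α) :
    kernelAt κ (Function.update x i a) t = kernelAt κ x t := by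
  simp only [Occurs, not_or, ← ne_eq] at ht
  simp only [kernelAt, Function.update_of_ne ht.1.symm, Function.update_of_ne ht.2.1.symm,
    Function.update_of_ne ht.2.2.symm]

lemma tripleSum_eq_add (κ : α → α → α → ℝ) (s : Finset ι) (i : ι) (x : ι → α) :
    tripleSum κ s x = occurSum κ s i x + tripleSum κ (s.erase i) x := by
  rw [tripleSum, tripleSum, triples_erase, occurSum, Finset.sum_filter_add_sum_filter_not]

lemma tripleSum_erase_update (x : ι → α) (a : α) :
    tripleSum κ (s.erase i) (Function.update x i a) = tripleSum κ (s.erase i) x := by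
  rw [tripleSum, tripleSum, triples_erase]
  exact Finset.sum_congr rfl fun t ht => kernelAt_update (Finset.mem_filter.1 ht).2 x a

lemma dependsOn_tripleSum (κ : α → α → α → ℝ) (s : Finset ι) : DependsOn (tripleSum κ s) s := by
  refine fun x y hxy => Finset.sum_congr rfl fun t ht => ?_
  obtain ⟨⟨h₁, h₂, h₃⟩, -⟩ := mem_triples.1 ht
  rw [kernelAt, kernelAt, hxy _ h₁, hxy _ h₂, hxy _ h₃]

lemma dependsOn_uStat (κ : α → α → α → ℝ) (s : Finset ι) : DependsOn (uStat κ s) s :=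
  fun _ _ hxy => congrArg (_ * ·) (dependsOn_tripleSum κ s hxy)

lemma dependsOn_jackknife (κ : α → α → α → ℝ) (s : Finset ι) (i : ι) :
    DependsOn (jackknife κ s i) s := by
  intro x y hxy
  rw [jackknife, jackknife, dependsOn_uStat κ s hxy,
    dependsOn_uStat κ (s.erase i) fun j hj => hxy j (Finset.mem_of_mem_erase hj)]

lemma sum_tripleSum_erase (hs : 3 ≤ #s) (x : ι → α) :
    ∑ i ∈ s, tripleSum κ (s.erase i) x = (#s - 3) * tripleSum κ s x := by
  simp only [tripleSum, triples_erase, Finset.sum_filter]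
  rw [Finset.sum_comm, Finset.mul_sum]
  refine Finset.sum_congr rfl fun t ht => ?_
  have hcard : #{i ∈ s | ¬Occurs i t} = #s - 3 := by
    have hsplit := Finset.card_filter_add_card_filter_not (s := s) fun i => Occurs i t
    rw [card_filter_occurs_of_mem ht] at hsplit
    omega
  rw [← Finset.sum_filter, Finset.sum_const, hcard, nsmul_eq_mul, Nat.cast_sub hs, Nat.cast_ofNat]

lemma cast_choose_three (n : ℕ) : (n.choose 3 : ℝ) = n * (n - 1) * (n - 2) / 6 := by
  have h := Nat.cast_inj (R := ℝ).2 (sum_range_choose_eq n 2)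
  rw [← h, Nat.cast_sum]
  clear h
  induction n with
  | zero => simp
  | succ n ih =>
    rw [Finset.sum_range_succ, ih, Nat.cast_choose_two]
    push_cast
    ring

lemma uStat_eq (κ : α → α → α → ℝ) (s : Finset ι) (x : ι → α) :
    uStat κ s x = 6 / (#s * (#s - 1) * (#s - 2)) * tripleSum κ s x := by
  rw [uStat, cast_choose_three, inv_div]

lemma uStat_erase_eq (hi : i ∈ s) (x : ι → α) :
    uStat κ (s.erase i) x = 6 / ((#s - 1) * (#s - 2) * (#s - 3)) * tripleSum κ (s.erase i) x := by
  rw [uStat_eq, Finset.cast_card_erase_of_mem hi]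
  ring_nf

lemma sum_jackknife (hs : 4 ≤ #s) (x : ι → α) :
    ∑ i ∈ s, jackknife κ s i x = #s * uStat κ s x := by
  have hs' : (4 : ℝ) ≤ #s := by exact_mod_cast hs
  have h₁ : (#s : ℝ) - 1 ≠ 0 := by linarith
  have h₂ : (#s : ℝ) - 2 ≠ 0 := by linarith
  have h₃ : (#s : ℝ) - 3 ≠ 0 := by linarith
  have herase : ∑ i ∈ s, uStat κ (s.erase i) x = #s * uStat κ s x := by
    rw [Finset.sum_congr rfl fun i hi => uStat_erase_eq hi x, ← Finset.mul_sum,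
      sum_tripleSum_erase (by omega), uStat_eq]
    field_simp
  simp only [jackknife]
  rw [Finset.sum_sub_distrib, ← Finset.mul_sum _ (fun i => uStat κ (s.erase i) x), herase,
    Finset.sum_const, nsmul_eq_mul]
  ring

lemma jackknife_eq (hs : 4 ≤ #s) (hi : i ∈ s) (x : ι → α) :
    jackknife κ s i x = 6 / ((#s - 1) * (#s - 2)) * occurSum κ s i x
      - 12 / ((#s - 1) * (#s - 2) * (#s - 3)) * tripleSum κ (s.erase i) x := by
  have hs' : (4 : ℝ) ≤ #s := by exact_mod_cast hs
  have h₁ : (#s : ℝ) - 1 ≠ 0 := by linarith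
  have h₂ : (#s : ℝ) - 2 ≠ 0 := by linarith
  have h₃ : (#s : ℝ) - 3 ≠ 0 := by linarith
  rw [jackknife, uStat_erase_eq hi, uStat_eq, tripleSum_eq_add κ s i x]
  field_simp
  ring

lemma jackknife_sub_update (x : ι → α) (a : α) :
    jackknife κ s i x - jackknife κ s i (Function.update x i a)
      = #s * uStat κ s x - #s * uStat κ s (Function.update x i a) := by
  rw [jackknife, jackknife, uStat, uStat, uStat, uStat, tripleSum_erase_update]
  ring

lemma abs_sum_kernelAt_sub_update_le (hκ : ∀ a b c, |κ a b c| ≤ 1) (T : Finset (ι × ι × ι))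
    (x : ι → α) (a : α) :
    |∑ t ∈ T, kernelAt κ x t - ∑ t ∈ T, kernelAt κ (Function.update x j a) t|
      ≤ 2 * #{t ∈ T | Occurs j t} := by
  rw [← Finset.sum_filter_add_sum_filter_not T (Occurs j),
    ← Finset.sum_filter_add_sum_filter_not T (Occurs j) (kernelAt κ (Function.update x j a)),
    Finset.sum_congr rfl fun t ht => kernelAt_update (Finset.mem_filter.1 ht).2 x a,
    add_sub_add_right_eq_sub, two_mul]
  exact (abs_sub _ _).trans (add_le_add (abs_sum_kernelAt_le hκ _ x) (abs_sum_kernelAt_le hκ _ _))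

lemma abs_mul_sub_mul_le {a b c d A B : ℝ} (ha : 0 ≤ a) (hb : 0 ≤ b) (hc : |c| ≤ A)
    (hd : |d| ≤ B) : |a * c - b * d| ≤ a * A + b * B := by
  refine (abs_sub _ _).trans ?_
  rw [abs_mul, abs_mul, abs_of_nonneg ha, abs_of_nonneg hb]
  gcongr

lemma abs_jackknife_le (hκ : ∀ a b c, |κ a b c| ≤ 1) (hs : 4 ≤ #s) (hi : i ∈ s) (x : ι → α) :
    |jackknife κ s i x| ≤ 5 := by
  have hs' : (4 : ℝ) ≤ #s := by exact_mod_cast hs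
  have h₁ : 0 < (#s : ℝ) - 1 := by linarith
  have h₂ : 0 < (#s : ℝ) - 2 := by linarith
  have h₃ : 0 < (#s : ℝ) - 3 := by linarith
  have hoccur : |occurSum κ s i x| ≤ (#s - 1) * (#s - 2) / 2 := by
    refine (abs_sum_kernelAt_le hκ _ x).trans_eq ?_
    rw [card_filter_occurs hi, Nat.cast_choose_two, Nat.cast_sub (by omega)]
    push_cast
    ring
  have herase : |tripleSum κ (s.erase i) x| ≤ (#s - 1) * (#s - 2) * (#s - 3) / 6 := by
    refine (abs_sum_kernelAt_le hκ _ x).trans_eq ?_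
    rw [card_triples, cast_choose_three, Finset.cast_card_erase_of_mem hi]
    ring
  rw [jackknife_eq hs hi]
  refine (abs_mul_sub_mul_le (by positivity) (by positivity) hoccur herase).trans_eq ?_
  field_simp
  norm_num

lemma abs_jackknife_sub_update_le (hκ : ∀ a b c, |κ a b c| ≤ 1) (hs : 4 ≤ #s) (hi : i ∈ s)
    (hj : j ∈ s) (hij : i ≠ j) (x : ι → α) (b : α) :
    |jackknife κ s i x - jackknife κ s i (Function.update x j b)| ≤ 24 / (#s - 1) := by
  have hs' : (4 : ℝ) ≤ #s := by exact_mod_cast hs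
  have h₁ : 0 < (#s : ℝ) - 1 := by linarith
  have h₂ : 0 < (#s : ℝ) - 2 := by linarith
  have h₃ : 0 < (#s : ℝ) - 3 := by linarith
  have hoccur : |occurSum κ s i x - occurSum κ s i (Function.update x j b)| ≤ 2 * (#s - 2) := by
    refine (abs_sum_kernelAt_sub_update_le hκ _ x b).trans_eq ?_
    rw [Finset.filter_filter, card_filter_occurs_and_occurs hi hj hij, Nat.cast_sub (by omega),
      Nat.cast_ofNat]
  have herase : |tripleSum κ (s.erase i) x - tripleSum κ (s.erase i) (Function.update x j b)|
      ≤ (#s - 2) * (#s - 3) := by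
    refine (abs_sum_kernelAt_sub_update_le hκ _ x b).trans_eq ?_
    rw [card_filter_occurs (Finset.mem_erase.2 ⟨hij.symm, hj⟩), Nat.cast_choose_two,
      Finset.card_erase_of_mem hi, Nat.sub_sub, Nat.cast_sub (by omega)]
    push_cast
    ring
  rw [jackknife_eq hs hi, jackknife_eq hs hi, sub_sub_sub_comm, ← mul_sub, ← mul_sub]
  refine (abs_mul_sub_mul_le (by positivity) (by positivity) hoccur herase).trans_eq ?_
  field_simp
  norm_num

end UStatistic

/-! ### Moments of the jackknife -/

section SecondMoments

open scoped Finset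

lemma integral_add_sq_le {β : Type*} [MeasurableSpace β] {f g : β → ℝ} (hf : BddMeas f)
    (hg : BddMeas g) (ν : Measure β) [IsFiniteMeasure ν] :
    ∫ x, (f x + g x) ^ 2 ∂ν ≤ 2 * ∫ x, f x ^ 2 ∂ν + 2 * ∫ x, g x ^ 2 ∂ν := by
  rw [← integral_const_mul, ← integral_const_mul,
    ← integral_add ((hf.sq.const_mul 2).integrable ν) ((hg.sq.const_mul 2).integrable ν)]
  exact integral_mono ((hf.add hg).sq.integrable ν)
    (((hf.sq.const_mul 2).add (hg.sq.const_mul 2)).integrable ν) fun x => by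
      beta_reduce
      linarith [add_sq_le (a := f x) (b := g x)]

lemma sq_sum_sq_sub_sum_sq_le {ι : Type*} {s : Finset ι} {u v : ι → ℝ} {K : ℝ}
    (hu : ∀ i ∈ s, |u i| ≤ K) (hv : ∀ i ∈ s, |v i| ≤ K) :
    (∑ i ∈ s, u i ^ 2 - ∑ i ∈ s, v i ^ 2) ^ 2
      ≤ #s * ((2 * K) ^ 2 * ∑ i ∈ s, (u i - v i) ^ 2) := by
  rw [← Finset.sum_sub_distrib, Finset.mul_sum]
  refine sq_sum_le_card_mul_sum_sq.trans
    (mul_le_mul_of_nonneg_left (Finset.sum_le_sum fun i hi => ?_) (Nat.cast_nonneg _))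
  rw [sq_sub_sq, mul_pow]
  refine mul_le_mul_of_nonneg_right (sq_le_sq' ?_ ?_) (sq_nonneg _) <;>
    linarith [abs_le.1 (hu i hi), abs_le.1 (hv i hi)]

end SecondMoments

section JackknifeMoments

open scoped Finset

variable {ι α : Type*} [MeasurableSpace α] {κ : α → α → α → ℝ}

/-- A measurable kernel of degree three with values in `[-1, 1]`. -/
structure IsUnitKernel (κ : α → α → α → ℝ) : Prop where
  measurable : Measurable fun p : α × α × α => κ p.1 p.2.1 p.2.2
  abs_le_one : ∀ a b c, |κ a b c| ≤ 1

lemma IsUnitKernel.bddMeas_comp {β : Type*} [MeasurableSpace β] (hκ : IsUnitKernel κ)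
    {u v w : β → α} (hu : Measurable u) (hv : Measurable v) (hw : Measurable w) :
    BddMeas fun y => κ (u y) (v y) (w y) :=
  ⟨hκ.measurable.comp (hu.prodMk (hv.prodMk hw)), 1, fun _ => hκ.abs_le_one _ _ _⟩

lemma IsUnitKernel.bddMeas_kernelAt (hκ : IsUnitKernel κ) (t : ι × ι × ι) :
    BddMeas fun x : ι → α => kernelAt κ x t :=
  hκ.bddMeas_comp (measurable_pi_apply _) (measurable_pi_apply _) (measurable_pi_apply _)

/-- The conditional mean of the kernel given its first argument. -/
noncomputable def firstProj (κ : α → α → α → ℝ) (μ : Measure α) (a : α) : ℝ :=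
  ∫ b, ∫ c, κ a b c ∂μ ∂μ

/-- The conditional mean of the kernel given its last argument. -/
noncomputable def lastProj (κ : α → α → α → ℝ) (μ : Measure α) (c : α) : ℝ :=
  ∫ a, ∫ b, κ a b c ∂μ ∂μ

variable (μ : Measure α) [IsProbabilityMeasure μ] {i j : ι}

lemma IsUnitKernel.bddMeas_firstProj (hκ : IsUnitKernel κ) : BddMeas (firstProj κ μ) :=
  ((hκ.bddMeas_comp (β := (α × α) × α) (measurable_fst.comp measurable_fst)
    (measurable_snd.comp measurable_fst) measurable_snd).integral_right μ).integral_right μ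

lemma IsUnitKernel.bddMeas_lastProj (hκ : IsUnitKernel κ) : BddMeas (lastProj κ μ) :=
  ((hκ.bddMeas_comp (β := (α × α) × α) (measurable_snd.comp measurable_fst) measurable_snd
    (measurable_fst.comp measurable_fst)).integral_right μ).integral_right μ

lemma integral_eval_prod_infinitePi {f : α → α → ℝ} (hf : BddMeas fun p : α × α => f p.1 p.2)
    (hij : i ≠ j) :
    ∫ x, f (x i) (x j) ∂Measure.infinitePi (fun _ : ι => μ) = ∫ a, ∫ b, f a b ∂μ ∂μ := by
  rw [← integral_prod (fun p : α × α => f p.1 p.2) (hf.integrable _),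
    ← Measure.infinitePi_map_eval_prod (P := fun _ : ι => μ) hij,
    integral_map (by fun_prop) hf.1.aestronglyMeasurable]

variable [LinearOrder ι] {s : Finset ι} {t : ι × ι × ι}

lemma integral_kernelAt_update_fst (hκ : IsUnitKernel κ) (ht : t ∈ triples s) (a : α) :
    ∫ x, kernelAt κ (Function.update x t.1 a) t ∂Measure.infinitePi (fun _ : ι => μ)
      = firstProj κ μ a := by
  obtain ⟨-, h₂₁, h₃₂⟩ := mem_triples.1 ht
  rw [firstProj, ← integral_eval_prod_infinitePi μ
    (hκ.bddMeas_comp measurable_const measurable_fst measurable_snd) h₃₂.ne']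
  simp only [kernelAt, Function.update_self, Function.update_of_ne h₂₁.ne,
    Function.update_of_ne (h₃₂.trans h₂₁).ne]

lemma integral_kernelAt_update_snd_snd (hκ : IsUnitKernel κ) (ht : t ∈ triples s) (c : α) :
    ∫ x, kernelAt κ (Function.update x t.2.2 c) t ∂Measure.infinitePi (fun _ : ι => μ)
      = lastProj κ μ c := by
  obtain ⟨-, h₂₁, h₃₂⟩ := mem_triples.1 ht
  rw [lastProj, ← integral_eval_prod_infinitePi (f := fun a b => κ a b c) μ
    (hκ.bddMeas_comp measurable_fst measurable_snd measurable_const) h₂₁.ne']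
  simp only [kernelAt, Function.update_self, Function.update_of_ne h₃₂.ne',
    Function.update_of_ne (h₃₂.trans h₂₁).ne']

lemma integral_kernelAt (hκ : IsUnitKernel κ) (ht : t ∈ triples s) :
    ∫ x, kernelAt κ x t ∂Measure.infinitePi (fun _ : ι => μ) = ∫ a, firstProj κ μ a ∂μ := by
  rw [← integral_integral_update (fun _ => μ) (hκ.bddMeas_kernelAt t) t.1]
  simp only [integral_kernelAt_update_fst μ hκ ht]

lemma IsUnitKernel.bddMeas_uStat (hκ : IsUnitKernel κ) (s : Finset ι) : BddMeas (uStat κ s) :=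
  (BddMeas.sum fun t _ => hκ.bddMeas_kernelAt t).const_mul _

lemma IsUnitKernel.bddMeas_jackknife (hκ : IsUnitKernel κ) (s : Finset ι) (i : ι) :
    BddMeas (jackknife κ s i) :=
  ((hκ.bddMeas_uStat s).const_mul _).sub ((hκ.bddMeas_uStat (s.erase i)).const_mul _)

lemma integral_uStat (hκ : IsUnitKernel κ) (hmean : ∫ a, firstProj κ μ a ∂μ = 0) (s : Finset ι) :
    ∫ x, uStat κ s x ∂Measure.infinitePi (fun _ : ι => μ) = 0 := by
  simp only [uStat, tripleSum]
  rw [integral_const_mul, integral_finsetSum _ fun t _ => (hκ.bddMeas_kernelAt t).integrable _,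
    Finset.sum_eq_zero fun t ht => (integral_kernelAt μ hκ ht).trans hmean, mul_zero]

/-- The Hájek projection of the `i`-th jackknife pseudo-value onto the `i`-th observation. -/
noncomputable def score (κ : α → α → α → ℝ) (μ : Measure α) (s : Finset ι) (i : ι) : α → ℝ :=
  hajekProj (fun _ => μ) i (jackknife κ s i)

/-- The mean of the variances of the scores. -/
noncomputable def scoreVar (κ : α → α → α → ℝ) (μ : Measure α) (s : Finset ι) : ℝ :=
  (∑ i ∈ s, ∫ a, score κ μ s i a ^ 2 ∂μ) / #s

lemma IsUnitKernel.bddMeas_score (hκ : IsUnitKernel κ) (s : Finset ι) (i : ι) :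
    BddMeas (score κ μ s i) :=
  (hκ.bddMeas_jackknife s i).hajekProj (fun _ => μ) i

lemma abs_score_le (hκ : IsUnitKernel κ) (hs : 4 ≤ #s) (hi : i ∈ s) (a : α) :
    |score κ μ s i a| ≤ 5 :=
  abs_hajekProj_le (fun _ => μ) (abs_jackknife_le hκ.abs_le_one hs hi) a

lemma integral_score (hκ : IsUnitKernel κ) (hmean : ∫ a, firstProj κ μ a ∂μ = 0) (s : Finset ι)
    (i : ι) : ∫ a, score κ μ s i a ∂μ = 0 := by
  refine (integral_integral_update (fun _ => μ) (hκ.bddMeas_jackknife s i) i).trans ?_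
  simp only [jackknife]
  rw [integral_sub (((hκ.bddMeas_uStat s).const_mul _).integrable _)
    (((hκ.bddMeas_uStat _).const_mul _).integrable _), integral_const_mul, integral_const_mul,
    integral_uStat μ hκ hmean, integral_uStat μ hκ hmean, mul_zero, mul_zero, sub_zero]

lemma integral_jackknife_sub_score_sq_le (hκ : IsUnitKernel κ) (hs : 4 ≤ #s) (hi : i ∈ s) :
    ∫ x, (jackknife κ s i x - score κ μ s i (x i)) ^ 2 ∂Measure.infinitePi (fun _ : ι => μ)
      ≤ 1024 / #s := by
  have hs' : (4 : ℝ) ≤ #s := by exact_mod_cast hs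
  have hrate : 24 / ((#s : ℝ) - 1) ≤ 32 / #s := by
    rw [div_le_div_iff₀ (by linarith) (by linarith)]
    linarith
  refine (integral_sub_hajekProj_sq_le (c := 32 / #s) (fun _ => μ) (hκ.bddMeas_jackknife s i)
    (dependsOn_jackknife κ s i) fun j hj hji x b => ?_).trans_eq ?_
  · exact (abs_jackknife_sub_update_le hκ.abs_le_one hs hi hj hji.symm x b).trans hrate
  · field_simp
    norm_num

lemma integral_sum_jackknife_sub_sum_score_sq_le (hκ : IsUnitKernel κ)
    (hmean : ∫ a, firstProj κ μ a ∂μ = 0) (hs : 4 ≤ #s) :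
    ∫ x, (∑ i ∈ s, jackknife κ s i x - ∑ i ∈ s, score κ μ s i (x i)) ^ 2
      ∂Measure.infinitePi (fun _ : ι => μ) ≤ 4096 := by
  have hs' : (#s : ℝ) ≠ 0 := by exact_mod_cast (by omega : #s ≠ 0)
  have hU : BddMeas fun x : ι → α => #s * uStat κ s x := (hκ.bddMeas_uStat s).const_mul _
  have hscore (i : ι) : BddMeas fun x : ι → α => score κ μ s i (x i) :=
    (hκ.bddMeas_score μ s i).comp (measurable_pi_apply i)
  have hsum : BddMeas fun x : ι → α => ∑ i ∈ s, score κ μ s i (x i) :=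
    BddMeas.sum fun i _ => hscore i
  have hzero : ∫ x, (#s * uStat κ s x - ∑ i ∈ s, score κ μ s i (x i))
      ∂Measure.infinitePi (fun _ : ι => μ) = 0 := by
    rw [integral_sub (hU.integrable _) (hsum.integrable _), integral_const_mul,
      integral_uStat μ hκ hmean, integral_finsetSum _ fun i _ => (hscore i).integrable _,
      Finset.sum_eq_zero fun i _ => ?_, mul_zero, sub_zero]
    rw [integral_eval_infinitePi (fun _ => μ) (hκ.bddMeas_score μ s i), integral_score μ hκ hmean]
  have hdep : DependsOn (fun x : ι → α => #s * uStat κ s x) s := fun x y hxy =>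
    congrArg ((#s : ℝ) * ·) (dependsOn_uStat κ s hxy)
  simp only [sum_jackknife hs]
  rw [← variance_of_integral_eq_zero (hU.sub hsum).1.aemeasurable hzero]
  refine (variance_sub_sum_hajekProj_le (fun _ => μ) hU hdep (fun i => hκ.bddMeas_jackknife s i)
    fun i _ x a => (jackknife_sub_update x a).symm).trans ?_
  refine (mul_le_mul_of_nonneg_left (Finset.sum_le_card_nsmul s _ _ fun i hi =>
    integral_jackknife_sub_score_sq_le μ hκ hs hi) zero_le_four).trans_eq ?_
  rw [nsmul_eq_mul, mul_div_cancel₀ _ hs']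
  norm_num

lemma integral_sum_sq_jackknife_sub_sum_sq_score_sq_le (hκ : IsUnitKernel κ) (hs : 4 ≤ #s) :
    ∫ x, (∑ i ∈ s, jackknife κ s i x ^ 2 - ∑ i ∈ s, score κ μ s i (x i) ^ 2) ^ 2
      ∂Measure.infinitePi (fun _ : ι => μ) ≤ 102400 * #s := by
  have hs' : (#s : ℝ) ≠ 0 := by exact_mod_cast (by omega : #s ≠ 0)
  have hscore (i : ι) : BddMeas fun x : ι → α => score κ μ s i (x i) :=
    (hκ.bddMeas_score μ s i).comp (measurable_pi_apply i)
  have hdiff (i : ι) : BddMeas fun x : ι → α => (jackknife κ s i x - score κ μ s i (x i)) ^ 2 :=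
    ((hκ.bddMeas_jackknife s i).sub (hscore i)).sq
  calc _ ≤ ∫ x, #s * ((2 * 5) ^ 2 * ∑ i ∈ s, (jackknife κ s i x - score κ μ s i (x i)) ^ 2)
        ∂Measure.infinitePi (fun _ : ι => μ) := by
        refine integral_mono (((BddMeas.sum fun i _ => (hκ.bddMeas_jackknife s i).sq).sub
          (BddMeas.sum fun i _ => (hscore i).sq)).sq.integrable _)
          ((((BddMeas.sum fun i _ => hdiff i).const_mul _).const_mul _).integrable _) fun x => ?_
        exact sq_sum_sq_sub_sum_sq_le (fun i hi => abs_jackknife_le hκ.abs_le_one hs hi x)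
          fun i hi => abs_score_le μ hκ hs hi (x i)
    _ = #s * ((2 * 5) ^ 2 * ∑ i ∈ s, ∫ x, (jackknife κ s i x - score κ μ s i (x i)) ^ 2
        ∂Measure.infinitePi (fun _ : ι => μ)) := by
        rw [integral_const_mul, integral_const_mul,
          integral_finsetSum _ fun i _ => (hdiff i).integrable _]
    _ ≤ #s * ((2 * 5) ^ 2 * (#s * (1024 / #s))) := by
        gcongr
        exact (Finset.sum_le_card_nsmul s _ _ fun i hi =>
          integral_jackknife_sub_score_sq_le μ hκ hs hi).trans_eq (nsmul_eq_mul _ _)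
    _ = 102400 * #s := by
        rw [mul_div_cancel₀ _ hs']
        ring

lemma variance_sum_sq_score_le (hκ : IsUnitKernel κ) (hs : 4 ≤ #s) :
    variance (fun x => ∑ i ∈ s, score κ μ s i (x i) ^ 2) (Measure.infinitePi (fun _ : ι => μ))
      ≤ 625 * #s := by
  have hsq (i : ι) (hi : i ∈ s) (a : α) : score κ μ s i a ^ 2 ≤ 5 ^ 2 :=
    sq_le_sq' (abs_le.1 (abs_score_le μ hκ hs hi a)).1 (abs_le.1 (abs_score_le μ hκ hs hi a)).2
  refine (variance_sum_eval_le (fun _ => μ) (f := fun i a => score κ μ s i a ^ 2) (c := 5 ^ 2)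
    (fun i => (hκ.bddMeas_score μ s i).sq)
    fun i hi a b => abs_sub_le_of_nonneg_of_le (sq_nonneg _) (hsq i hi a) (sq_nonneg _)
      (hsq i hi b)).trans_eq ?_
  ring

lemma integral_mean_sq_jackknife_sub_scoreVar_sq_le (hκ : IsUnitKernel κ) (hs : 4 ≤ #s) :
    ∫ x, ((∑ i ∈ s, jackknife κ s i x ^ 2) / #s - scoreVar κ μ s) ^ 2
      ∂Measure.infinitePi (fun _ : ι => μ) ≤ 206050 / #s := by
  have hs' : (#s : ℝ) ≠ 0 := by exact_mod_cast (by omega : #s ≠ 0)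
  have hscore (i : ι) : BddMeas fun x : ι → α => score κ μ s i (x i) ^ 2 :=
    ((hκ.bddMeas_score μ s i).comp (measurable_pi_apply i)).sq
  have hsum : BddMeas fun x : ι → α => ∑ i ∈ s, score κ μ s i (x i) ^ 2 :=
    BddMeas.sum fun i _ => hscore i
  have hmean : ∫ x, ∑ i ∈ s, score κ μ s i (x i) ^ 2 ∂Measure.infinitePi (fun _ : ι => μ)
      = #s * scoreVar κ μ s := by
    rw [integral_finsetSum _ fun i _ => (hscore i).integrable _, scoreVar, mul_div_cancel₀ _ hs']
    exact Finset.sum_congr rfl fun i _ =>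
      integral_eval_infinitePi (fun _ => μ) (hκ.bddMeas_score μ s i).sq
  have hfluct := variance_sum_sq_score_le μ hκ hs
  rw [variance_eq_integral hsum.1.aemeasurable, hmean] at hfluct
  have hbound := (integral_add_sq_le ((BddMeas.sum fun i _ => (hκ.bddMeas_jackknife s i).sq).sub
    hsum) (hsum.sub (BddMeas.const (#s * scoreVar κ μ s)))
    (Measure.infinitePi (fun _ : ι => μ))).trans (add_le_add
    (mul_le_mul_of_nonneg_left (integral_sum_sq_jackknife_sub_sum_sq_score_sq_le μ hκ hs)
      zero_le_two) (mul_le_mul_of_nonneg_left hfluct zero_le_two))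
  simp only [sub_add_sub_cancel] at hbound
  calc _ = (∫ x, (∑ i ∈ s, jackknife κ s i x ^ 2 - #s * scoreVar κ μ s) ^ 2
        ∂Measure.infinitePi (fun _ : ι => μ)) / #s ^ 2 := by
        rw [← integral_div]
        congr with x
        field_simp
    _ ≤ (2 * (102400 * #s) + 2 * (625 * #s)) / #s ^ 2 := by gcongr
    _ = 206050 / #s := by
        field_simp
        norm_num

end JackknifeMoments

/-! ### Nondegeneracy of the scores -/

section Nondegeneracy

open scoped Finset

variable {ι α : Type*} [MeasurableSpace α] [LinearOrder ι] {κ : α → α → α → ℝ} (μ : Measure α)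
  [IsProbabilityMeasure μ] {s : Finset ι} {i : ι}

lemma score_eq (hκ : IsUnitKernel κ) (hmean : ∫ a, firstProj κ μ a ∂μ = 0) (hs : 4 ≤ #s)
    (hi : i ∈ s) (a : α) :
    score κ μ s i a = 3 / ((#s - 1).choose 2 : ℕ) * ∑ t ∈ triples s with Occurs i t,
      ∫ x, kernelAt κ (Function.update x i a) t ∂Measure.infinitePi (fun _ : ι => μ) := by
  have hupd (t : ι × ι × ι) : Integrable (fun x => kernelAt κ (Function.update x i a) t)
      (Measure.infinitePi (fun _ : ι => μ)) :=
    ((hκ.bddMeas_kernelAt t).comp (by fun_prop)).integrable _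
  have htriple : Integrable (tripleSum κ (s.erase i)) (Measure.infinitePi fun _ : ι => μ) :=
    (BddMeas.sum fun t _ => hκ.bddMeas_kernelAt t).integrable _
  have hother : ∫ x, tripleSum κ (s.erase i) x ∂Measure.infinitePi (fun _ : ι => μ) = 0 := by
    simp only [tripleSum]
    rw [integral_finsetSum _ fun t _ => (hκ.bddMeas_kernelAt t).integrable _,
      Finset.sum_eq_zero fun t ht => (integral_kernelAt μ hκ ht).trans hmean]
  have hchoose : (((#s - 1).choose 2 : ℕ) : ℝ) = (#s - 1) * (#s - 2) / 2 := by
    rw [Nat.cast_choose_two, Nat.cast_sub (by omega)]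
    push_cast
    ring
  simp only [score, hajekProj, jackknife_eq hs hi, tripleSum_erase_update, occurSum]
  rw [integral_sub ((integrable_finsetSum _ fun t _ => hupd t).const_mul _)
    (htriple.const_mul _), integral_const_mul, integral_const_mul, hother,
    integral_finsetSum _ fun t _ => hupd t, mul_zero, sub_zero, hchoose, ← div_mul,
    div_mul_eq_mul_div, div_mul_eq_mul_div, div_mul_eq_mul_div]
  ring

lemma abs_score_sub_le (hκ : IsUnitKernel κ) (hmean : ∫ a, firstProj κ μ a ∂μ = 0) (hs : 4 ≤ #s)
    (hi : i ∈ s) {T : Finset (ι × ι × ι)} (hT : T ⊆ {t ∈ triples s | Occurs i t}) {a : α} {p : ℝ}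
    (hp : ∀ t ∈ T, ∫ x, kernelAt κ (Function.update x i a) t
      ∂Measure.infinitePi (fun _ : ι => μ) = p) :
    |score κ μ s i a - 3 * (#T / ((#s - 1).choose 2 : ℕ)) * p|
      ≤ 3 * (1 - #T / ((#s - 1).choose 2 : ℕ)) := by
  have hpos : (0 : ℝ) < ((#s - 1).choose 2 : ℕ) := by
    exact_mod_cast Nat.choose_pos (by omega)
  have hcard : (#({t ∈ triples s | Occurs i t} \ T) : ℝ) = ((#s - 1).choose 2 : ℕ) - #T := by
    rw [Finset.cast_card_sdiff hT, card_filter_occurs hi]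
  have hrest : |∑ t ∈ {t ∈ triples s | Occurs i t} \ T,
      ∫ x, kernelAt κ (Function.update x i a) t ∂Measure.infinitePi (fun _ : ι => μ)|
        ≤ ((#s - 1).choose 2 : ℕ) - #T := by
    rw [← hcard, ← nsmul_one]
    refine (Finset.abs_sum_le_sum_abs _ _).trans (Finset.sum_le_card_nsmul _ _ _ fun t _ => ?_)
    refine (abs_integral_le_integral_abs.trans (integral_mono_of_nonneg
      (Eventually.of_forall fun _ => abs_nonneg _) (integrable_const 1)
      (Eventually.of_forall fun _ => hκ.abs_le_one _ _ _))).trans_eq ?_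
    simp
  rw [score_eq μ hκ hmean hs hi, ← Finset.sum_sdiff hT, Finset.sum_congr rfl hp, Finset.sum_const,
    nsmul_eq_mul]
  calc _ = |3 / (((#s - 1).choose 2 : ℕ) : ℝ) * ∑ t ∈ {t ∈ triples s | Occurs i t} \ T,
        ∫ x, kernelAt κ (Function.update x i a) t ∂Measure.infinitePi (fun _ : ι => μ)| := by
        ring_nf
    _ ≤ 3 / (((#s - 1).choose 2 : ℕ) : ℝ) * (((#s - 1).choose 2 : ℕ) - #T) := by
        rw [abs_mul, abs_of_nonneg (by positivity)]
        gcongr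
    _ = _ := by
        field_simp

lemma le_integral_sq_of_abs_sub_le {f g : α → ℝ} (hf : BddMeas f) (hg : BddMeas g) {ρ v : ℝ}
    (hv : 0 ≤ v) (hv1 : v ≤ 1) (hρ : 1 - v / 4 ≤ ρ) (hvg : v ≤ ∫ a, g a ^ 2 ∂μ) (hρ1 : ρ ≤ 1)
    (h : ∀ a, |f a - 3 * ρ * g a| ≤ 3 * (1 - ρ)) : v ≤ ∫ a, f a ^ 2 ∂μ := by
  have hpoint (a : α) : 9 * ρ ^ 2 * g a ^ 2 ≤ 2 * f a ^ 2 + 18 * (1 - ρ) ^ 2 := by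
    have := sq_le_sq' (abs_le.1 (h a)).1 (abs_le.1 (h a)).2
    nlinarith [sq_nonneg (2 * f a - 3 * ρ * g a)]
  have hint := integral_mono ((hg.sq.const_mul (9 * ρ ^ 2)).integrable μ)
    (((hf.sq.const_mul 2).add (BddMeas.const _)).integrable μ) hpoint
  rw [integral_const_mul, integral_add ((hf.sq.const_mul 2).integrable μ) (integrable_const _),
    integral_const_mul, integral_const, probReal_univ, one_smul] at hint
  nlinarith [mul_nonneg (mul_nonneg hv (sub_nonneg.2 hv1)) hv]

lemma one_sub_le_choose_two_div {v : ℝ} {m n : ℕ} (hv : 0 ≤ v) (hv1 : v ≤ 1) (hn : 3 ≤ n)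
    (hvn : 16 ≤ v * n) (hm : (1 - v / 16) * n ≤ m) :
    1 - v / 4 ≤ (m.choose 2 : ℝ) / ((n - 1).choose 2 : ℕ) := by
  have hn' : (3 : ℝ) ≤ n := by exact_mod_cast hn
  rw [Nat.cast_choose_two, Nat.cast_choose_two, Nat.cast_sub (by omega), Nat.cast_one,
    div_div_div_cancel_right₀ two_ne_zero, le_div_iff₀ (by nlinarith)]
  have hm' : (1 - v / 8) * n ≤ m - 1 := by nlinarith
  nlinarith [mul_le_mul hm hm' (by nlinarith) (by linarith), mul_nonneg hv hv]

lemma sq_div_mul_le_sum_range {v : ℝ} {n : ℕ} (hv : 0 < v) (hv1 : v ≤ 1) (hvn : 32 ≤ v * n) :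
    v ^ 2 / 32 * n ≤ ∑ m ∈ Finset.range n,
      if 1 - v / 4 ≤ (m.choose 2 : ℝ) / ((n - 1).choose 2 : ℕ) then v else 0 := by
  have hn : 3 ≤ n := by
    have : (3 : ℝ) ≤ n := by nlinarith
    exact_mod_cast this
  have hceil : (⌈(1 - v / 16) * n⌉₊ : ℝ) ≤ (1 - v / 32) * n :=
    (Nat.ceil_lt_add_one (by nlinarith)).le.trans (by linarith)
  have hsub : Finset.Ico ⌈(1 - v / 16) * n⌉₊ n ⊆ {m ∈ Finset.range n |
      1 - v / 4 ≤ (m.choose 2 : ℝ) / ((n - 1).choose 2 : ℕ)} := fun m hm =>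
    Finset.mem_filter.2 ⟨Finset.mem_range.2 (Finset.mem_Ico.1 hm).2, one_sub_le_choose_two_div hv.le
      hv1 hn (by linarith) (Nat.ceil_le.1 (Finset.mem_Ico.1 hm).1)⟩
  calc v ^ 2 / 32 * n ≤ (n - ⌈(1 - v / 16) * n⌉₊ : ℝ) * v := by nlinarith
    _ = #(Finset.Ico ⌈(1 - v / 16) * n⌉₊ n) * v := by
        rw [Nat.card_Ico, Nat.cast_sub (Nat.ceil_le.2 (by nlinarith))]
    _ ≤ #{m ∈ Finset.range n | 1 - v / 4 ≤ (m.choose 2 : ℝ) / ((n - 1).choose 2 : ℕ)} * v := by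
        gcongr
    _ = _ := by
        rw [← Finset.sum_filter, Finset.sum_const, nsmul_eq_mul]

lemma sq_div_le_scoreVar_of_occurs {v : ℝ} {g : α → ℝ} (hκ : IsUnitKernel κ)
    (hmean : ∫ a, firstProj κ μ a ∂μ = 0) (hg : BddMeas g) (hv : 0 < v) (hv1 : v ≤ 1)
    (hvg : v ≤ ∫ a, g a ^ 2 ∂μ) (hs : 32 ≤ v * #s) {T : ι → Finset (ι × ι × ι)} {r : ι → ℕ}
    (hr : ∀ f : ℕ → ℝ, ∑ i ∈ s, f (r i) = ∑ m ∈ Finset.range #s, f m)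
    (hT : ∀ i, T i ⊆ {t ∈ triples s | Occurs i t})
    (hcard : ∀ i ∈ s, #(T i) = (r i).choose 2)
    (hp : ∀ i ∈ s, ∀ a, ∀ t ∈ T i, ∫ x, kernelAt κ (Function.update x i a) t
      ∂Measure.infinitePi (fun _ : ι => μ) = g a) :
    v ^ 2 / 32 ≤ scoreVar κ μ s := by
  have hs4 : 4 ≤ #s := by
    have : (4 : ℝ) ≤ #s := by nlinarith
    exact_mod_cast this
  rw [scoreVar, le_div_iff₀ (by nlinarith)]
  refine (sq_div_mul_le_sum_range hv hv1 hs).trans ((hr _).symm.trans_le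
    (Finset.sum_le_sum fun i hi => ?_))
  split_ifs with hρ
  swap
  · positivity
  rw [← hcard i hi] at hρ
  refine le_integral_sq_of_abs_sub_le μ (hκ.bddMeas_score μ s i) hg hv.le hv1 hρ hvg ?_
    fun a => abs_score_sub_le μ hκ hmean hs4 hi (hT i) (hp i hi a)
  refine div_le_one_of_le₀ ?_ (Nat.cast_nonneg _)
  rw [← card_filter_occurs hi]
  exact_mod_cast Finset.card_le_card (hT i)

lemma sq_div_le_scoreVar_of_le_integral_firstProj_sq (hκ : IsUnitKernel κ)
    (hmean : ∫ a, firstProj κ μ a ∂μ = 0) {v : ℝ} (hv : 0 < v) (hv1 : v ≤ 1)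
    (hvp : v ≤ ∫ a, firstProj κ μ a ^ 2 ∂μ) (hs : 32 ≤ v * #s) :
    v ^ 2 / 32 ≤ scoreVar κ μ s := by
  refine sq_div_le_scoreVar_of_occurs μ hκ hmean (hκ.bddMeas_firstProj μ) hv hv1 hvp hs
    (fun f => sum_card_filter_lt f s)
    (fun i => Finset.monotone_filter_right _ fun t _ ht => Or.inl ht.symm)
    (fun i hi => card_filter_fst_eq hi) fun i _ a t hti => ?_
  obtain ⟨ht, rfl⟩ := Finset.mem_filter.1 hti
  exact integral_kernelAt_update_fst μ hκ ht a

lemma sq_div_le_scoreVar_of_le_integral_lastProj_sq (hκ : IsUnitKernel κ)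
    (hmean : ∫ a, firstProj κ μ a ∂μ = 0) {v : ℝ} (hv : 0 < v) (hv1 : v ≤ 1)
    (hvp : v ≤ ∫ a, lastProj κ μ a ^ 2 ∂μ) (hs : 32 ≤ v * #s) :
    v ^ 2 / 32 ≤ scoreVar κ μ s := by
  refine sq_div_le_scoreVar_of_occurs μ hκ hmean (hκ.bddMeas_lastProj μ) hv hv1 hvp hs
    (fun f => sum_card_filter_gt f s)
    (fun i => Finset.monotone_filter_right _ fun t _ ht => Or.inr (Or.inr ht.symm))
    (fun i hi => card_filter_snd_snd_eq hi) fun i _ a t hti => ?_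
  obtain ⟨ht, rfl⟩ := Finset.mem_filter.1 hti
  exact integral_kernelAt_update_snd_snd μ hκ ht a

lemma exists_pos_forall_le_scoreVar (hκ : IsUnitKernel κ) (hmean : ∫ a, firstProj κ μ a ∂μ = 0)
    (h : 0 < ∫ a, firstProj κ μ a ^ 2 ∂μ ∨ 0 < ∫ a, lastProj κ μ a ^ 2 ∂μ) :
    ∃ c > 0, ∃ N : ℕ, ∀ s : Finset ι, N ≤ #s → c ≤ scoreVar κ μ s := by
  have hlarge {v : ℝ} (hv : 0 < v)
      (h : ∀ s : Finset ι, 32 ≤ v * #s → v ^ 2 / 32 ≤ scoreVar κ μ s) :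
      ∃ c > 0, ∃ N : ℕ, ∀ s : Finset ι, N ≤ #s → c ≤ scoreVar κ μ s :=
    ⟨v ^ 2 / 32, by positivity, ⌈32 / v⌉₊, fun s hs =>
      h s ((div_le_iff₀' hv).1 (Nat.ceil_le.1 hs))⟩
  rcases h with h | h
  · exact hlarge (lt_min h one_pos) fun s =>
      sq_div_le_scoreVar_of_le_integral_firstProj_sq μ hκ hmean (lt_min h one_pos)
        (min_le_right _ _) (min_le_left _ _)
  · exact hlarge (lt_min h one_pos) fun s =>
      sq_div_le_scoreVar_of_le_integral_lastProj_sq μ hκ hmean (lt_min h one_pos)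
        (min_le_right _ _) (min_le_left _ _)

end Nondegeneracy

/-! ### The adjusted jackknife empirical likelihood ratio -/

section Kernel

open scoped Finset

variable {s : Finset ℕ} {n i : ℕ}

/-- The centred kernel of the statistic `deltaStar`. -/
noncomputable def kern (a b c : ℝ) : ℝ := ind a b c - 1 / 2

lemma isUnitKernel_kern : IsUnitKernel kern where
  measurable := measurable_ind.sub_const _
  abs_le_one a b c := by
    rw [kern, ind]
    split_ifs <;> norm_num [abs_le]

lemma deltaStar_eq_uStat (hs : 3 ≤ #s) (x : ℕ → ℝ) : deltaStar s x = uStat kern s x := by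
  have hchoose : (((#s).choose 3 : ℕ) : ℝ) ≠ 0 := by exact_mod_cast (Nat.choose_pos hs).ne'
  rw [deltaStar, uStat, ← sum_triples s fun i j k => ind (x i) (x j) (x k)]
  simp only [tripleSum, kernelAt, kern]
  rw [Finset.sum_sub_distrib, Finset.sum_const, card_triples, nsmul_eq_mul, mul_sub,
    inv_mul_cancel_left₀ hchoose]

lemma pseudoValue_eq_jackknife (hn : 4 ≤ n) (hi : i ∈ Finset.range n) (x : ℕ → ℝ) :
    pseudoValue n x i = jackknife kern (Finset.range n) i x := by
  have hcard : 3 ≤ #((Finset.range n).erase i) := by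
    rw [Finset.card_erase_of_mem hi, Finset.card_range]
    omega
  rw [pseudoValue, jackknife, deltaStar_eq_uStat (by rw [Finset.card_range]; omega),
    deltaStar_eq_uStat hcard, Finset.card_range]

lemma measurable_deltaStar (s : Finset ℕ) : Measurable (deltaStar s) :=
  ((Finset.measurable_fun_sum _ fun i _ => Finset.measurable_fun_sum _ fun j _ =>
    Finset.measurable_fun_sum _ fun k _ => measurable_ind.comp ((measurable_pi_apply i).prodMk
      ((measurable_pi_apply j).prodMk (measurable_pi_apply k)))).const_mul _).sub_const _

lemma measurable_adjustedValue (n : ℕ) (i : Fin (n + 1)) :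
    Measurable fun x => adjustedValue n x i := by
  have hpseudo (j : ℕ) : Measurable fun x => pseudoValue n x j :=
    ((measurable_deltaStar _).const_mul _).sub ((measurable_deltaStar _).const_mul _)
  unfold adjustedValue
  split_ifs
  · exact hpseudo i
  · exact ((Finset.measurable_fun_sum _ fun j _ => hpseudo j).const_mul _).const_mul _

/-- The multiple of the mean pseudo-value which is subtracted as the additional value. -/
noncomputable def adjustment (n : ℕ) : ℝ := max 1 ((1 / 2) * Real.log n)

lemma one_le_adjustment (n : ℕ) : 1 ≤ adjustment n := le_max_left _ _

lemma tendsto_adjustment_div_sqrt : Tendsto (fun n : ℕ => adjustment n / √n) atTop (nhds 0) := by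
  have hone : Tendsto (fun n : ℕ => (1 : ℝ) / √n) atTop (nhds 0) :=
    tendsto_const_nhds.div_atTop (Real.tendsto_sqrt_atTop.comp tendsto_natCast_atTop_atTop)
  have hlog : Tendsto (fun n : ℕ => Real.log n / √n) atTop (nhds 0) := by
    simpa only [Real.sqrt_eq_rpow] using! (isLittleO_log_rpow_atTop
      one_half_pos).tendsto_div_nhds_zero.comp tendsto_natCast_atTop_atTop
  have hmax := hone.max (hlog.const_mul (1 / 2))
  rw [mul_zero, max_self] at hmax
  refine hmax.congr fun n => ?_
  rw [adjustment, ← mul_div_assoc, max_div_div_right (Real.sqrt_nonneg _)]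

lemma sum_comp_adjustedValue (hn : 4 ≤ n) (f : ℝ → ℝ) (x : ℕ → ℝ) :
    ∑ i, f (adjustedValue n x i) = ∑ i ∈ Finset.range n, f (jackknife kern (Finset.range n) i x)
      + f (adjustedValue n x (Fin.last n)) := by
  rw [Fin.sum_univ_castSucc, Finset.sum_range]
  congr 1
  exact Finset.sum_congr rfl fun i _ => by
    rw [adjustedValue_castSucc, pseudoValue_eq_jackknife hn (Finset.mem_range.2 i.2)]

lemma abs_pseudoValue_le (hn : 4 ≤ n) (hi : i ∈ Finset.range n) (x : ℕ → ℝ) :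
    |pseudoValue n x i| ≤ 5 := by
  rw [pseudoValue_eq_jackknife hn hi]
  exact abs_jackknife_le isUnitKernel_kern.abs_le_one (by rwa [Finset.card_range]) hi x

lemma abs_adjustedValue_le (hn : 4 ≤ n) (x : ℕ → ℝ) (i : Fin (n + 1)) :
    |adjustedValue n x i| ≤ adjustment n * 5 := by
  have hadj := one_le_adjustment n
  induction i using Fin.lastCases with
  | cast i =>
    rw [adjustedValue_castSucc]
    linarith [abs_pseudoValue_le hn (Finset.mem_range.2 i.2) x]
  | last =>
    have hmean : |1 / (n : ℝ) * ∑ j ∈ Finset.range n, pseudoValue n x j| ≤ 5 := by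
      have hsum : |∑ j ∈ Finset.range n, pseudoValue n x j| ≤ n * 5 := by
        simpa using (Finset.abs_sum_le_sum_abs _ _).trans
          (Finset.sum_le_card_nsmul _ _ _ fun j hj => abs_pseudoValue_le hn hj x)
      rw [abs_mul, abs_of_nonneg (by positivity), one_div_mul_eq_div]
      exact div_le_of_le_mul₀ (by positivity) (by norm_num) (by linarith)
    rw [adjustedValue_last, abs_mul, abs_neg, ← adjustment, abs_of_nonneg (by linarith)]
    gcongr

end Kernel

section Moments

variable (μ : Measure ℝ) [IsProbabilityMeasure μ] {n : ℕ}

lemma bddMeas_adjustedValue (hn : 4 ≤ n) (i : Fin (n + 1)) :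
    BddMeas fun x => adjustedValue n x i :=
  ⟨measurable_adjustedValue n i, _, fun x => abs_adjustedValue_le hn x i⟩

lemma sq_adjustedValue_le (hn : 4 ≤ n) (x : ℕ → ℝ) (i : Fin (n + 1)) :
    adjustedValue n x i ^ 2 ≤ 25 * adjustment n ^ 2 :=
  (sq_le_sq' (abs_le.1 (abs_adjustedValue_le hn x i)).1
    (abs_le.1 (abs_adjustedValue_le hn x i)).2).trans_eq (by ring)

lemma bddMeas_sum_score (n : ℕ) : BddMeas fun x : ℕ → ℝ =>
    ∑ i ∈ Finset.range n, score kern μ (Finset.range n) i (x i) :=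
  BddMeas.sum fun i _ =>
    (isUnitKernel_kern.bddMeas_score μ (Finset.range n) i).comp (measurable_pi_apply i)

lemma integral_sum_adjustedValue_sub_sum_score_sq_le (hmean : ∫ a, firstProj kern μ a ∂μ = 0)
    (hn : 4 ≤ n) :
    ∫ x, (∑ i, adjustedValue n x i - ∑ i ∈ Finset.range n, score kern μ (Finset.range n) i (x i))
      ^ 2 ∂Measure.infinitePi (fun _ : ℕ => μ) ≤ 8242 * adjustment n ^ 2 := by
  have hjack : BddMeas fun x => ∑ i ∈ Finset.range n, jackknife kern (Finset.range n) i x :=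
    BddMeas.sum fun i _ => isUnitKernel_kern.bddMeas_jackknife _ i
  have hsum := integral_add_sq_le (hjack.sub (bddMeas_sum_score μ n))
    (bddMeas_adjustedValue hn (Fin.last n)) (Measure.infinitePi fun _ : ℕ => μ)
  have hlast := integral_mono
    ((bddMeas_adjustedValue hn (Fin.last n)).sq.integrable (Measure.infinitePi fun _ : ℕ => μ))
    (integrable_const _) fun x => sq_adjustedValue_le hn x (Fin.last n)
  rw [integral_const, probReal_univ, one_smul] at hlast
  have hadj := one_le_pow₀ (n := 2) (one_le_adjustment n)
  simp only [sum_comp_adjustedValue hn fun w => w, add_sub_right_comm]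
  linarith [integral_sum_jackknife_sub_sum_score_sq_le μ isUnitKernel_kern hmean
    (hn.trans_eq (Finset.card_range n).symm)]

lemma integral_sum_sq_adjustedValue_sub_scoreVar_sq_le (hn : 4 ≤ n) :
    ∫ x, ((∑ i, adjustedValue n x i ^ 2) / n - scoreVar kern μ (Finset.range n)) ^ 2
      ∂Measure.infinitePi (fun _ : ℕ => μ)
        ≤ 412100 / n + 1250 * (adjustment n ^ 2 / n) ^ 2 := by
  have hjack : BddMeas fun x : ℕ → ℝ =>
      (∑ i ∈ Finset.range n, jackknife kern (Finset.range n) i x ^ 2) / n := by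
    simpa only [div_eq_inv_mul] using (BddMeas.sum fun i _ =>
      (isUnitKernel_kern.bddMeas_jackknife (Finset.range n) i).sq).const_mul (n : ℝ)⁻¹
  have hlast : BddMeas fun x => adjustedValue n x (Fin.last n) ^ 2 / n := by
    simpa only [div_eq_inv_mul] using (bddMeas_adjustedValue hn (Fin.last n)).sq.const_mul (n : ℝ)⁻¹
  have hsum := integral_add_sq_le (hjack.sub (BddMeas.const (scoreVar kern μ (Finset.range n))))
    hlast (Measure.infinitePi fun _ : ℕ => μ)
  have hlast_le := integral_mono (hlast.sq.integrable (Measure.infinitePi fun _ : ℕ => μ))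
    (integrable_const ((25 * adjustment n ^ 2 / n) ^ 2)) fun x => by
      beta_reduce
      gcongr
      exact sq_adjustedValue_le hn x (Fin.last n)
  rw [integral_const, probReal_univ, one_smul] at hlast_le
  have hvar := integral_mean_sq_jackknife_sub_scoreVar_sq_le μ isUnitKernel_kern
    (hn.trans_eq (Finset.card_range n).symm)
  rw [Finset.card_range] at hvar
  simp only [sum_comp_adjustedValue hn fun w => w ^ 2, add_div, add_sub_right_comm]
  calc _ ≤ 2 * (206050 / n : ℝ) + 2 * (25 * adjustment n ^ 2 / n) ^ 2 := by linarith
    _ = _ := by ring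

end Moments

section Limit

variable (μ : Measure ℝ) {c : ℝ}

/-- The standard deviation of the sum of the scores of `x 0, …, x (n - 1)`. -/
noncomputable def scoreScale (n : ℕ) : ℝ :=
  √(n * scoreVar kern μ (Finset.range n))

lemma scoreScale_sq {n : ℕ} (h : 0 ≤ scoreVar kern μ (Finset.range n)) :
    scoreScale μ n ^ 2 = n * scoreVar kern μ (Finset.range n) :=
  Real.sq_sqrt (by positivity)

lemma scoreScale_pos {n : ℕ} (hn : 4 ≤ n) (h : 0 < scoreVar kern μ (Finset.range n)) :
    0 < scoreScale μ n :=
  Real.sqrt_pos.2 (mul_pos (by exact_mod_cast (by omega : 0 < n)) h)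

lemma tendsto_mul_adjustment_div_scoreScale (hc : 0 < c)
    (hcv : ∀ᶠ n in atTop, c ≤ scoreVar kern μ (Finset.range n)) :
    Tendsto (fun n => adjustment n * 5 / scoreScale μ n) atTop (nhds 0) := by
  have hlim := tendsto_adjustment_div_sqrt.mul_const (5 / √c)
  rw [zero_mul] at hlim
  have hadj (n : ℕ) : 0 ≤ adjustment n := zero_le_one.trans (one_le_adjustment n)
  refine squeeze_zero' (.of_forall fun n => div_nonneg (mul_nonneg (hadj n) (by norm_num))
    (Real.sqrt_nonneg _)) ?_ hlim
  filter_upwards [hcv, eventually_ge_atTop 1] with n hn hn1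
  have hn0 : (0 : ℝ) < n := by exact_mod_cast hn1
  have := hadj n
  rw [div_mul_div_comm, ← Real.sqrt_mul hn0.le, scoreScale]
  gcongr

variable [IsProbabilityMeasure μ]

lemma tendstoInDistribution_sum_score_div (hmean : ∫ a, firstProj kern μ a ∂μ = 0) (hc : 0 < c)
    (hcv : ∀ᶠ n in atTop, c ≤ scoreVar kern μ (Finset.range n)) :
    TendstoInDistribution
      (fun n x => ∑ i ∈ Finset.range n,
        score kern μ (Finset.range n) i (x i) / scoreScale μ n) atTop (id : ℝ → ℝ)
      (fun _ => Measure.infinitePi (fun _ : ℕ => μ)) (gaussianReal 0 1) := by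
  have hscaled (n i : ℕ) : BddMeas fun a => score kern μ (Finset.range n) i a / scoreScale μ n := by
    simpa only [div_eq_inv_mul] using
      (isUnitKernel_kern.bddMeas_score μ (Finset.range n) i).const_mul (scoreScale μ n)⁻¹
  refine tendstoInDistribution_sum_of_tendsto_bound
    (fun n => iIndepFun_infinitePi fun i => (hscaled n i).1)
    (fun n i => (hscaled n i).comp (measurable_pi_apply i)) (fun n i => ?_) ?_
    (tendsto_mul_adjustment_div_scoreScale μ hc hcv) ?_
  · rw [integral_eval_infinitePi (fun _ => μ) (hscaled n i), integral_div,
      integral_score μ isUnitKernel_kern hmean, zero_div]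
  · filter_upwards [eventually_ge_atTop 4] with n hn i hi x
    have hscale : 0 ≤ scoreScale μ n := Real.sqrt_nonneg _
    rw [abs_div, abs_of_nonneg hscale]
    refine div_le_div_of_nonneg_right ?_ hscale
    linarith [one_le_adjustment n, abs_score_le μ isUnitKernel_kern
      (hn.trans_eq (Finset.card_range n).symm) hi (x i)]
  · filter_upwards [hcv, eventually_ge_atTop 4] with n hn hn4
    have hvar : 0 < scoreVar kern μ (Finset.range n) := hc.trans_le hn
    have hn0 : (n : ℝ) ≠ 0 := by exact_mod_cast (by omega : n ≠ 0)
    rw [Finset.sum_congr rfl fun i _ => integral_eval_infinitePi (fun _ => μ) (hscaled n i).sq]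
    simp only [div_pow, integral_div]
    rw [← Finset.sum_div, scoreScale_sq μ hvar.le, scoreVar, Finset.card_range,
      mul_div_cancel₀ _ hn0, div_self]
    intro hsum
    rw [scoreVar, hsum, zero_div] at hvar
    exact hvar.false

lemma tendstoInMeasure_sum_adjustedValue_div_sub (hmean : ∫ a, firstProj kern μ a ∂μ = 0)
    (hc : 0 < c) (hcv : ∀ᶠ n in atTop, c ≤ scoreVar kern μ (Finset.range n)) :
    TendstoInMeasure (Measure.infinitePi (fun _ : ℕ => μ))
      (fun n x => (∑ i, adjustedValue n x i) / scoreScale μ n - ∑ i ∈ Finset.range n,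
        score kern μ (Finset.range n) i (x i) / scoreScale μ n) atTop 0 := by
  have hrate := ((tendsto_mul_adjustment_div_scoreScale μ hc hcv).pow 2).const_mul (8242 / 25)
  rw [zero_pow two_ne_zero, mul_zero] at hrate
  have hdiff (n : ℕ) (x : ℕ → ℝ) : ((∑ i, adjustedValue n x i) / scoreScale μ n
      - ∑ i ∈ Finset.range n, score kern μ (Finset.range n) i (x i) / scoreScale μ n
      - (0 : (ℕ → ℝ) → ℝ) x) ^ 2
      = (∑ i, adjustedValue n x i
          - ∑ i ∈ Finset.range n, score kern μ (Finset.range n) i (x i)) ^ 2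
        / scoreScale μ n ^ 2 := by
    rw [← Finset.sum_div, Pi.zero_apply, sub_zero, ← sub_div, div_pow]
  refine tendstoInMeasure_of_integral_sq_sub_le ?_ ?_ hrate
  · filter_upwards [eventually_ge_atTop 4] with n hn
    simp only [hdiff]
    exact (((BddMeas.sum fun i _ => bddMeas_adjustedValue hn i).sub
      (bddMeas_sum_score μ n)).sq.integrable _).div_const _
  · filter_upwards [eventually_ge_atTop 4] with n hn
    simp only [hdiff, integral_div]
    refine (div_le_div_of_nonneg_right
      (integral_sum_adjustedValue_sub_sum_score_sq_le μ hmean hn) (sq_nonneg _)).trans_eq ?_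
    ring

lemma tendstoInMeasure_sum_sq_adjustedValue_div (hc : 0 < c)
    (hcv : ∀ᶠ n in atTop, c ≤ scoreVar kern μ (Finset.range n)) :
    TendstoInMeasure (Measure.infinitePi (fun _ : ℕ => μ))
      (fun n x => (∑ i, adjustedValue n x i ^ 2) / scoreScale μ n ^ 2) atTop fun _ => 1 := by
  have hrate : Tendsto (fun n : ℕ => (412100 / n + 1250 * ((adjustment n / √n) ^ 2) ^ 2) / c ^ 2)
      atTop (nhds 0) := by
    simpa using ((tendsto_const_div_atTop_nhds_zero_nat (412100 : ℝ)).add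
      (((tendsto_adjustment_div_sqrt.pow 2).pow 2).const_mul 1250)).div_const (c ^ 2)
  have hdiff {n : ℕ} (hcn : c ≤ scoreVar kern μ (Finset.range n)) (x : ℕ → ℝ) :
      ((∑ i, adjustedValue n x i ^ 2) / scoreScale μ n ^ 2 - 1) ^ 2
      = ((∑ i, adjustedValue n x i ^ 2) / n - scoreVar kern μ (Finset.range n)) ^ 2
        / scoreVar kern μ (Finset.range n) ^ 2 := by
    have hvar := hc.trans_le hcn
    rw [scoreScale_sq μ hvar.le, ← div_div, ← div_pow, sub_div, div_self hvar.ne']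
  refine tendstoInMeasure_of_integral_sq_sub_le ?_ ?_ hrate
  · filter_upwards [eventually_ge_atTop 4] with n hn
    have hsum : BddMeas fun x => (∑ i, adjustedValue n x i ^ 2) / scoreScale μ n ^ 2 := by
      simpa only [div_eq_inv_mul] using (BddMeas.sum fun i _ =>
        (bddMeas_adjustedValue hn i).sq).const_mul (scoreScale μ n ^ 2)⁻¹
    exact (hsum.sub (BddMeas.const 1)).sq.integrable _
  · filter_upwards [eventually_ge_atTop 4, hcv] with n hn hcn
    simp only [hdiff hcn, integral_div]
    rw [div_pow (adjustment n), Real.sq_sqrt (Nat.cast_nonneg n)]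
    gcongr
    exact integral_sum_sq_adjustedValue_sub_scoreVar_sq_le μ hn

theorem tendstoInDistribution_neg_two_mul_log_ajelRatio (hmean : ∫ a, firstProj kern μ a ∂μ = 0)
    (hpos : 0 < ∫ a, firstProj kern μ a ^ 2 ∂μ ∨ 0 < ∫ a, lastProj kern μ a ^ 2 ∂μ) :
    TendstoInDistribution (fun (n : ℕ) (x : ℕ → ℝ) => -2 * Real.log (ajelRatio n x)) atTop
      (id : ℝ → ℝ) (fun _ => Measure.infinitePi (fun _ : ℕ => μ)) chiSquaredOne := by
  obtain ⟨c, hc, N, hN⟩ := exists_pos_forall_le_scoreVar (ι := ℕ) μ isUnitKernel_kern hmean hpos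
  have hcv : ∀ᶠ n in atTop, c ≤ scoreVar kern μ (Finset.range n) := by
    filter_upwards [eventually_ge_atTop N] with n hn
    exact hN _ (hn.trans_eq (Finset.card_range n).symm)
  have hsum := tendstoInDistribution_of_tendstoInMeasure_sub _ _
    (tendstoInDistribution_sum_score_div μ hmean hc hcv)
    (tendstoInMeasure_sum_adjustedValue_div_sub μ hmean hc hcv)
    fun n => ((Finset.measurable_fun_sum _ fun i _ =>
      measurable_adjustedValue n i).div_const _).aemeasurable
  have hwilks := tendstoInDistribution_neg_two_mul_log_elRatio (s := scoreScale μ)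
    (fun n => Nat.succ_pos n)
    ((eventually_ge_atTop 4).mono fun n hn x =>
      ⟨exists_isMultiplier_adjustedValue (by omega) x, abs_adjustedValue_le hn x⟩)
    ((hcv.and (eventually_ge_atTop 4)).mono fun n hn => scoreScale_pos μ hn.2 (hc.trans_le hn.1))
    (tendsto_mul_adjustment_div_scoreScale μ hc hcv) hsum
    (tendstoInMeasure_sum_sq_adjustedValue_div μ hc hcv)
    (fun n => (Finset.measurable_fun_sum _ fun i _ =>
      (measurable_adjustedValue n i).pow_const 2).aemeasurable)
    fun n => (measurable_ajelRatio n).aemeasurable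
  refine ⟨hwilks.forall_aemeasurable, aemeasurable_id, ?_⟩
  convert! hwilks.tendsto using 2
  ext1
  simp only [Measure.map_id]
  rfl

end Limit

/-! ### The conditional mean of the symmetrized kernel -/

section Conditioning

lemma condExp_comp_prodMk_of_indepFun {Ω β γ : Type*} [MeasurableSpace Ω] {P : Measure Ω}
    [IsProbabilityMeasure P] [mβ : MeasurableSpace β] [MeasurableSpace γ] [StandardBorelSpace γ]
    [Nonempty γ] {Y : Ω → β} {Z : Ω → γ} (hY : Measurable Y) (hZ : Measurable Z)
    (hYZ : IndepFun Y Z P) {f : β × γ → ℝ} (hf : BddMeas f) :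
    P[fun ω => f (Y ω, Z ω) | mβ.comap Y] =ᵐ[P] fun ω => ∫ z, f (Y ω, z) ∂P.map Z := by
  have hdistrib : condDistrib Z Y P =ᵐ[P.map Y] Kernel.const β (P.map Z) :=
    condDistrib_ae_eq_of_measure_eq_compProd Y hZ.aemeasurable <| by
      rw [Measure.compProd_const,
        (indepFun_iff_map_prod_eq_prod_map_map hY.aemeasurable hZ.aemeasurable).1 hYZ]
  filter_upwards [condExp_prod_ae_eq_integral_condDistrib' hY hZ.aemeasurable (hf.integrable _),
    ae_of_ae_map hY.aemeasurable hdistrib] with ω hcond hω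
  rw [hcond, hω, Kernel.const_apply]

lemma integral_lastProj {α : Type*} [MeasurableSpace α] {κ : α → α → α → ℝ} (μ : Measure α)
    [IsProbabilityMeasure μ] (hκ : IsUnitKernel κ) :
    ∫ c, lastProj κ μ c ∂μ = ∫ a, firstProj κ μ a ∂μ := by
  have ht : ((2, 1, 0) : ℕ × ℕ × ℕ) ∈ triples (Finset.range 3) := by decide
  rw [← integral_kernelAt μ hκ ht,
    ← integral_integral_update (fun _ => μ) (hκ.bddMeas_kernelAt (2, 1, 0)) 0]
  simp only [integral_kernelAt_update_snd_snd μ hκ ht]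

lemma h_eq_kern (a b c : ℝ) : h a b c = (kern a b c + kern a c b + kern b c a) / 3 := by
  unfold h kern
  ring

variable (μ : Measure ℝ) [IsProbabilityMeasure μ]

lemma bddMeas_h : BddMeas fun p : ℝ × ℝ × ℝ => h p.1 p.2.1 p.2.2 := by
  have hkern {u v w : ℝ × ℝ × ℝ → ℝ} (hu : Measurable u) (hv : Measurable v) (hw : Measurable w) :
      BddMeas fun p => kern (u p) (v p) (w p) := isUnitKernel_kern.bddMeas_comp hu hv hw
  have hsum := (((hkern measurable_fst (by fun_prop : Measurable fun p => p.2.1)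
    (by fun_prop : Measurable fun p => p.2.2)).add (hkern measurable_fst
    (by fun_prop : Measurable fun p => p.2.2) (by fun_prop : Measurable fun p => p.2.1))).add
    (hkern (by fun_prop : Measurable fun p => p.2.1) (by fun_prop : Measurable fun p => p.2.2)
      measurable_fst)).const_mul (1 / 3)
  simpa only [h_eq_kern, div_eq_inv_mul, mul_one] using hsum

/-- The conditional mean of the symmetrized kernel `h` given its first argument. -/
noncomputable def hProj (μ : Measure ℝ) (a : ℝ) : ℝ :=
  (2 * firstProj kern μ a + lastProj kern μ a) / 3

lemma bddMeas_hProj : BddMeas (hProj μ) := by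
  unfold hProj
  simpa only [div_eq_inv_mul] using
    (((isUnitKernel_kern.bddMeas_firstProj μ).const_mul 2).add
      (isUnitKernel_kern.bddMeas_lastProj μ)).const_mul (3 : ℝ)⁻¹

lemma integral_hProj : ∫ a, hProj μ a ∂μ = ∫ a, firstProj kern μ a ∂μ := by
  simp only [hProj]
  rw [integral_div, integral_add
      (((isUnitKernel_kern.bddMeas_firstProj μ).const_mul 2).integrable μ)
      ((isUnitKernel_kern.bddMeas_lastProj μ).integrable μ),
    integral_const_mul, integral_lastProj μ isUnitKernel_kern]
  ring

lemma integral_hProj_sq_le : ∫ a, hProj μ a ^ 2 ∂μ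
    ≤ 2 * ∫ a, firstProj kern μ a ^ 2 ∂μ + ∫ a, lastProj kern μ a ^ 2 ∂μ := by
  have hfirst := (isUnitKernel_kern.bddMeas_firstProj μ).sq.const_mul 2
  have hlast := (isUnitKernel_kern.bddMeas_lastProj μ).sq
  rw [← integral_const_mul, ← integral_add (hfirst.integrable μ) (hlast.integrable μ)]
  refine integral_mono ((bddMeas_hProj μ).sq.integrable μ) ((hfirst.add hlast).integrable μ)
    fun a => ?_
  simp only [hProj]
  nlinarith [sq_nonneg (firstProj kern μ a - lastProj kern μ a),
    sq_nonneg (firstProj kern μ a), sq_nonneg (lastProj kern μ a)]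

lemma integral_h_prod (a : ℝ) : ∫ p, h a p.1 p.2 ∂μ.prod μ = hProj μ a := by
  have hfst : BddMeas fun p : ℝ × ℝ => kern a p.1 p.2 :=
    isUnitKernel_kern.bddMeas_comp measurable_const measurable_fst measurable_snd
  have hswap : BddMeas fun p : ℝ × ℝ => kern a p.2 p.1 :=
    isUnitKernel_kern.bddMeas_comp measurable_const measurable_snd measurable_fst
  have hlast : BddMeas fun p : ℝ × ℝ => kern p.1 p.2 a :=
    isUnitKernel_kern.bddMeas_comp measurable_fst measurable_snd measurable_const
  simp only [h_eq_kern]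
  rw [integral_div, integral_add ((hfst.add hswap).integrable _) (hlast.integrable _),
    integral_add (hfst.integrable _) (hswap.integrable _),
    integral_prod _ (hfst.integrable _), integral_prod_symm _ (hswap.integrable _),
    integral_prod _ (hlast.integrable _), hProj, firstProj, lastProj, two_mul]

section Sequence

variable {μ} {Ω ι : Type*} [MeasurableSpace Ω] {P : Measure Ω} [IsProbabilityMeasure P]
  {X : ι → Ω → ℝ} {i j k : ι}

lemma condExp_h (hX : ∀ i, Measurable (X i)) (hindep : iIndepFun X P)
    (hlaw : ∀ i, P.map (X i) = μ) (hij : i ≠ j) (hik : i ≠ k) (hjk : j ≠ k) :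
    P[fun ω => h (X i ω) (X j ω) (X k ω) | MeasurableSpace.comap (X i) inferInstance]
      =ᵐ[P] fun ω => hProj μ (X i ω) := by
  have hpair : P.map (fun ω => (X j ω, X k ω)) = μ.prod μ := by
    rw [(indepFun_iff_map_prod_eq_prod_map_map (hX j).aemeasurable (hX k).aemeasurable).1
      (hindep.indepFun hjk), hlaw, hlaw]
  have hcond := condExp_comp_prodMk_of_indepFun (hX i) ((hX j).prodMk (hX k))
    (hindep.indepFun_prodMk hX j k i hij.symm hik.symm).symm bddMeas_h
  simpa only [hpair, integral_h_prod μ] using hcond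

lemma integral_h (hX : ∀ i, Measurable (X i)) (hindep : iIndepFun X P)
    (hlaw : ∀ i, P.map (X i) = μ) (hij : i ≠ j) (hik : i ≠ k) (hjk : j ≠ k) :
    ∫ ω, h (X i ω) (X j ω) (X k ω) ∂P = ∫ a, firstProj kern μ a ∂μ := by
  rw [← integral_condExp (hX i).comap_le,
    integral_congr_ae (condExp_h hX hindep hlaw hij hik hjk),
    ← integral_map (hX i).aemeasurable (bddMeas_hProj μ).1.aestronglyMeasurable, hlaw,
    integral_hProj]

lemma integral_proj_sq_pos_of_variance_condExp_pos (hX : ∀ i, Measurable (X i))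
    (hindep : iIndepFun X P) (hlaw : ∀ i, P.map (X i) = μ)
    (hij : i ≠ j) (hik : i ≠ k) (hjk : j ≠ k)
    (hvar : 0 < variance (P[fun ω => h (X i ω) (X j ω) (X k ω) |
      MeasurableSpace.comap (X i) inferInstance]) P) :
    0 < ∫ a, firstProj kern μ a ^ 2 ∂μ ∨ 0 < ∫ a, lastProj kern μ a ^ 2 ∂μ := by
  have hsq : 0 < ∫ a, hProj μ a ^ 2 ∂μ := calc
    0 < _ := hvar
    _ = variance (fun ω => hProj μ (X i ω)) P :=
      variance_congr (condExp_h hX hindep hlaw hij hik hjk)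
    _ ≤ ∫ ω, hProj μ (X i ω) ^ 2 ∂P :=
      variance_le_expectation_sq ((bddMeas_hProj μ).comp (hX i)).1.aestronglyMeasurable
    _ = ∫ a, hProj μ a ^ 2 ∂μ := by
      rw [← integral_map (hX i).aemeasurable
        (f := fun a => hProj μ a ^ 2) (bddMeas_hProj μ).sq.1.aestronglyMeasurable, hlaw]
  by_contra! hzero
  linarith [integral_hProj_sq_le μ]

lemma tendstoInDistribution_neg_two_mul_log_ajelRatio_of_iIndepFun {X : ℕ → Ω → ℝ}
    (hX : ∀ i, Measurable (X i)) (hindep : iIndepFun X P) (hlaw : ∀ i, P.map (X i) = μ)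
    (hmean : ∫ a, firstProj kern μ a ∂μ = 0)
    (hpos : 0 < ∫ a, firstProj kern μ a ^ 2 ∂μ ∨ 0 < ∫ a, lastProj kern μ a ^ 2 ∂μ) :
    TendstoInDistribution (fun (n : ℕ) (ω : Ω) => -2 * Real.log (ajelRatio n fun i => X i ω)) atTop
      (id : ℝ → ℝ) (fun _ => P) chiSquaredOne := by
  have hmap : P.map (fun ω i => X i ω) = Measure.infinitePi (fun _ : ℕ => μ) := by
    simp only [hindep.map_fun_eq_infinitePi_map hX, hlaw]
  have hmeas : Measurable fun ω i => X i ω := measurable_pi_lambda _ hX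
  have hstat (n : ℕ) : Measurable fun x => -2 * Real.log (ajelRatio n x) :=
    (measurable_ajelRatio n).log.const_mul (-2)
  refine ⟨fun n => ((hstat n).comp hmeas).aemeasurable, aemeasurable_id,
    (tendstoInDistribution_neg_two_mul_log_ajelRatio μ hmean hpos).tendsto.congr fun n =>
      Subtype.ext ?_⟩
  exact (congrArg (Measure.map _) hmap.symm).trans (Measure.map_map (hstat n) hmeas)

end Sequence

end Conditioning

section Symmetric

lemma kern_add_kern_neg {a b c : ℝ} (hc : c ≠ (a * b - 1) / (2 * b)) :
    kern a b c + kern (-a) (-b) (-c) = 0 := by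
  have hneg : (-a * -b - 1) / (2 * -b) = -((a * b - 1) / (2 * b)) := by
    rw [neg_mul_neg, mul_neg, div_neg]
  unfold kern ind
  rw [hneg]
  rcases lt_or_gt_of_ne hc with hlt | hgt
  · rw [if_neg (not_le.2 hlt), if_pos (neg_le_neg hlt.le)]
    norm_num
  · rw [if_pos hgt.le, if_neg (not_le.2 (neg_lt_neg hgt))]
    norm_num

lemma integral_firstProj_kern (μ : Measure ℝ) [μ.IsNegInvariant] [NullSingletonClass μ] :
    ∫ a, firstProj kern μ a ∂μ = 0 := by
  have hneg (a b : ℝ) : ∫ c, kern (-a) (-b) c ∂μ = -∫ c, kern a b c ∂μ := by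
    rw [← integral_neg_eq_self, ← integral_neg]
    refine integral_congr_ae ?_
    filter_upwards [Measure.ae_ne μ ((a * b - 1) / (2 * b))] with c hc
    linarith [kern_add_kern_neg hc]
  have hodd (a : ℝ) : firstProj kern μ (-a) = -firstProj kern μ a := by
    simp only [firstProj]
    rw [← integral_neg_eq_self, ← integral_neg]
    simp only [hneg]
  have hself := integral_neg_eq_self (firstProj kern μ) μ
  simp only [hodd, integral_neg] at hself
  linarith

instance instNullSingletonClassCauchyMeasure : NullSingletonClass (cauchyMeasure 0 1) := by
  rw [cauchyMeasure_of_scale_ne_zero 0 one_ne_zero]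
  infer_instance

instance instIsNegInvariantCauchyMeasure : (cauchyMeasure 0 1).IsNegInvariant where
  neg_eq_self := by
    have heven (x : ℝ) : cauchyPDF 0 1 (-x) = cauchyPDF 0 1 x := by
      simp only [cauchyPDF_def, cauchyPDFReal_def, sub_zero, neg_sq]
    ext s hs
    rw [cauchyMeasure_of_scale_ne_zero 0 one_ne_zero, Measure.neg_def,
      Measure.map_apply measurable_neg hs, withDensity_apply _ (measurable_neg hs),
      withDensity_apply _ hs, ← (Measure.measurePreserving_neg volume).setLIntegral_comp_preimage
        hs (measurable_cauchyPDF 0 1)]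
    simp only [heven]

end Symmetric

end CauchyAJEL

theorem theorem4_general {Ω : Type*} [MeasurableSpace Ω] (P : Measure Ω) [IsProbabilityMeasure P]
    (X : ℕ → Ω → ℝ) (hX : ∀ i, Measurable (X i)) (hindep : iIndepFun X P)
    {μ : Measure ℝ} (hlaw : ∀ i, P.map (X i) = μ)
    (hmean : ∫ ω, CauchyAJEL.h (X 0 ω) (X 1 ω) (X 2 ω) ∂P = 0)
    (hvar : 0 < variance
      (P[fun ω => CauchyAJEL.h (X 0 ω) (X 1 ω) (X 2 ω) |
        MeasurableSpace.comap (X 0) inferInstance]) P) :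
    (∀ n : ℕ, 4 ≤ n → ∀ ω : Ω,
      (∃ l : ℝ, CauchyAJEL.IsMultiplier (CauchyAJEL.adjustedValue n (fun i => X i ω)) l) ∧
      ∀ l : ℝ, CauchyAJEL.IsMultiplier (CauchyAJEL.adjustedValue n (fun i => X i ω)) l →
        CauchyAJEL.multiplierWeight (CauchyAJEL.adjustedValue n (fun i => X i ω)) l ∈
          CauchyAJEL.feasible (CauchyAJEL.adjustedValue n (fun i => X i ω)) ∧
        IsMaxOn CauchyAJEL.likelihood
          (CauchyAJEL.feasible (CauchyAJEL.adjustedValue n (fun i => X i ω)))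
          (CauchyAJEL.multiplierWeight (CauchyAJEL.adjustedValue n (fun i => X i ω)) l) ∧
        Real.log (CauchyAJEL.ajelRatio n (fun i => X i ω)) =
          -∑ i, Real.log (1 + l * CauchyAJEL.adjustedValue n (fun i => X i ω) i)) ∧
    TendstoInDistribution
      (fun (n : ℕ) (ω : Ω) => -2 * Real.log (CauchyAJEL.ajelRatio n (fun i => X i ω)))
      atTop (id : ℝ → ℝ) (fun _ => P) CauchyAJEL.chiSquaredOne := by
  have : IsProbabilityMeasure μ := hlaw 0 ▸ Measure.isProbabilityMeasure_map (hX 0).aemeasurable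
  exact ⟨fun n hn ω => ⟨CauchyAJEL.exists_isMultiplier_adjustedValue (by omega) _, fun l hl =>
      ⟨CauchyAJEL.multiplierWeight_mem_feasible (Nat.succ_pos n) hl,
        CauchyAJEL.isMaxOn_likelihood (Nat.succ_pos n) hl,
        CauchyAJEL.log_elRatio (Nat.succ_pos n) hl⟩⟩,
    CauchyAJEL.tendstoInDistribution_neg_two_mul_log_ajelRatio_of_iIndepFun hX hindep hlaw
      ((CauchyAJEL.integral_h hX hindep hlaw (by decide) (by decide) (by decide)).symm.trans hmean)
      (CauchyAJEL.integral_proj_sq_pos_of_variance_condExp_pos hX hindep hlaw (by decide)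
        (by decide) (by decide) hvar)⟩

theorem theorem4 {Ω : Type*} [MeasurableSpace Ω] (P : Measure Ω) [IsProbabilityMeasure P]
    (X : ℕ → Ω → ℝ) (hX : ∀ i, Measurable (X i)) (hindep : iIndepFun X P)
    -- the null hypothesis: the common law is the standard Cauchy distribution
    (hlaw : ∀ i, P.map (X i) = cauchyMeasure 0 1)
    (hsq : Integrable (fun ω => CauchyAJEL.h (X 0 ω) (X 1 ω) (X 2 ω) ^ 2) P)
    (hvar : 0 < variance
      (P[fun ω => CauchyAJEL.h (X 0 ω) (X 1 ω) (X 2 ω) |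
        MeasurableSpace.comap (X 0) inferInstance]) P) :
    -- the maximum is attained and has the Lagrange multiplier form
    (∀ n : ℕ, 4 ≤ n → ∀ ω : Ω,
      (∃ l : ℝ, CauchyAJEL.IsMultiplier (CauchyAJEL.adjustedValue n (fun i => X i ω)) l) ∧
      ∀ l : ℝ, CauchyAJEL.IsMultiplier (CauchyAJEL.adjustedValue n (fun i => X i ω)) l →
        CauchyAJEL.multiplierWeight (CauchyAJEL.adjustedValue n (fun i => X i ω)) l ∈
          CauchyAJEL.feasible (CauchyAJEL.adjustedValue n (fun i => X i ω)) ∧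
        IsMaxOn CauchyAJEL.likelihood
          (CauchyAJEL.feasible (CauchyAJEL.adjustedValue n (fun i => X i ω)))
          (CauchyAJEL.multiplierWeight (CauchyAJEL.adjustedValue n (fun i => X i ω)) l) ∧
        Real.log (CauchyAJEL.ajelRatio n (fun i => X i ω)) =
          -∑ i, Real.log (1 + l * CauchyAJEL.adjustedValue n (fun i => X i ω) i)) ∧
    -- convergence in distribution of the statistic
    TendstoInDistribution
      (fun (n : ℕ) (ω : Ω) => -2 * Real.log (CauchyAJEL.ajelRatio n (fun i => X i ω)))
      atTop (id : ℝ → ℝ) (fun _ => P) CauchyAJEL.chiSquaredOne :=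
  theorem4_general P X hX hindep hlaw
    ((CauchyAJEL.integral_h hX hindep hlaw (by decide) (by decide) (by decide)).trans
      (CauchyAJEL.integral_firstProj_kern _)) hvar
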